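/- A monopolist sells $n$ goods to one buyer. The buyer first observes $\gamma\in\Gamma=[\underline\gamma,\overline\gamma]$, drawn from a distribution $G$ with density $g>0$. Given $\gamma$, the valuations $\theta\in\Theta=\prod_j[\underline\theta^j,\overline\theta^j]$ (nondegenerate intervals) have a joint distribution $F(\cdot|\gamma)$ with density $f(\theta|\gamma)>0$, continuously differentiable in $(\gamma,\theta)$ on $\Gamma\times\Theta$; $F^j,f^j$ are the marginal distribution functions and densities, and $F^j_\gamma=\partial F^j/\partial\gamma$. Let $$\phi^j(\gamma,\theta^j)=\theta^j+\frac{F^j_\gamma(\theta^j|\gamma)}{f^j(\theta^j|\gamma)}\,\frac{1-G(\gamma)}{g(\gamma)} .$$ Assume for every $j$ that $F^j_\gamma\le 0$, that $\phi^j$ is nondecreasing in $\gamma$, and that $\phi^j$ is single-crossing in $\theta^j$ on the open interval $(\underline\theta^j,\overline\theta^j)$ (once nonnegative, it stays nonnegative). Simultaneous selling: the monopolist chooses measurable $q:\Gamma\times\Theta\to[0,1]^n$, $t_1:\Gamma\to\mathbb R$, $t_2:\Gamma\times\Theta\to\mathbb R$ to maximize $\mathbb E[t_1(\gamma)+t_2(\gamma,\theta)]$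 subject to (IC1) $\gamma\in\arg\max_{\gamma'}\mathbb E_{\theta|\gamma}\big[\max_{\theta'}q(\gamma',\theta')\cdot\theta-t_1(\gamma')-t_2(\gamma',\theta')\big]$ for all $\gamma$; (IC2) $\theta\in\arg\max_{\theta'}q(\gamma,\theta')\cdot\theta-t_2(\gamma,\theta')$ for all $\gamma,\theta$; (IR) $\mathbb E_{\theta|\gamma}[q(\gamma,\theta)\cdot\theta-t_1(\gamma)-t_2(\gamma,\theta)]\ge0$ for all $\gamma$. Sequential selling over $n+1$ periods: the contract is written after the buyer observes $\gamma$; then in the period of good $j=1,\dots,n$ the buyer draws $\theta^j\sim F^j(\cdot|\gamma)$ and reports it, the report for good $j$ being a function of what the buyer has learned so far. The monopolist chooses measurable $q:\Gamma\times\Theta\to[0,1]^n$ and net transfers $t:\Gamma\times\Theta\to\mathbb R$ to maximize $\mathbb E[t(\gamma,\theta)]$ subject to: truth-telling throughout maximizes the buyer's expected payoff $\mathbb E[q\cdot\theta-t]$ over all reports of $\gamma$ followed by all reporting strategies, for every $\gamma$; at every truthful history $(\gamma,\theta^1,\dots,\theta^j)$, no strategy for the reports from period $j$ on has a higher conditional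 expected payoff than the truth; and the expected payoff given $\gamma$ is nonnegative for every $\gamma$. Proposition 1 (Irrelevance of Additional Periods). Suppose that the valuations $\theta^1,\dots,\theta^n$ are independent conditional on $\gamma$. Then: 1. If $(q,t_1,t_2)$ satisfies the constraints of the simultaneous problem, then $(q,t_1+t_2)$ satisfies those of the sequential problem and yields the same profit. 2. Some mechanism solves both problems (the simultaneous one as $(q,t_1,t_2)$, the sequential one as $(q,t_1+t_2)$). Its allocation rule is the pointwise optimal one, $q^j(\gamma,\theta)=1$ if $\phi^j(\gamma,\theta^j)\ge0$ and $q^j(\gamma,\theta)=0$ otherwise, for all $\gamma\in\Gamma$, $\theta\in\Theta$ and $j$ with $\theta^j>\underline\theta^j$; here $q^j$ depends only on $\gamma$ and $\theta^1,\dots,\theta^j$. The optimal profit of both problems is $\mathbb E\big[\sum_j\max\{\phi^j(\gamma,\theta^j),0\}\big]$. 3. Every solution of either problem has this allocation rule: for almost every $(\gamma,\theta)\in\Gamma\times\Theta$ and all $j$ with $\phi^j(\gamma,\theta^j)\ne0$, its $q^j(\gamma,\theta)$ is the pointwise optimal one. -/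

import Mathlib

open MeasureTheory ProbabilityTheory

noncomputable section

/-- The primitives of the screening problem with `n` goods.  The buyer's initial type `γ` lies in
`Γ = [γlo, γhi]` and has density `g`; given `γ`, the valuations `θ` lie in the box
`Θ = ∏ j, [lo j, hi j]` and have the joint conditional density `f γ`, which is continuously
differentiable in `(γ, θ)`.  Values of `f` and `g` outside of `Γ × Θ` and `Γ` are irrelevant.
Densities are positive, as the virtual values divide by them. -/
structure Environment (n : ℕ) where
  γlo : ℝ
  γhi : ℝ
  lo : Fin n → ℝ
  hi : Fin n → ℝ
  g : ℝ → ℝ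
  f : ℝ → (Fin n → ℝ) → ℝ
  γlo_lt_γhi : γlo < γhi
  lo_lt_hi : ∀ j, lo j < hi j
  measurable_g : Measurable g
  g_pos : ∀ γ ∈ Set.Icc γlo γhi, 0 < g γ
  integral_g : ∫ γ in Set.Icc γlo γhi, g γ = 1
  contDiffOn_f : ContDiffOn ℝ 1 (fun p : ℝ × (Fin n → ℝ) => f p.1 p.2)
    (Set.Icc γlo γhi ×ˢ Set.Icc lo hi)
  f_pos : ∀ γ ∈ Set.Icc γlo γhi, ∀ θ ∈ Set.Icc lo hi, 0 < f γ θ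
  integral_f : ∀ γ ∈ Set.Icc γlo γhi, ∫ θ in Set.Icc lo hi, f γ θ = 1

/-- A mechanism for selling all goods simultaneously: allocation, transfer due after the report of
`γ`, and transfer due after the report of `θ`. -/
structure SimMechanism (n : ℕ) where
  q : ℝ → (Fin n → ℝ) → (Fin n → ℝ)
  t₁ : ℝ → ℝ
  t₂ : ℝ → (Fin n → ℝ) → ℝ

/-- A mechanism for selling the goods sequentially: allocation and net transfer (the sum of all
payments; there is no discounting) as functions of the reports of all periods. -/
structure SeqMechanism (n : ℕ) where
  q : ℝ → (Fin n → ℝ) → (Fin n → ℝ)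
  t : ℝ → (Fin n → ℝ) → ℝ

/-- The same allocation and the same net transfer, as a sequential mechanism. -/
def SimMechanism.net {n : ℕ} (M : SimMechanism n) : SeqMechanism n where
  q := M.q
  t := fun γ θ => M.t₁ γ + M.t₂ γ θ

/-- The allocation of good `j` depends only on the reports of `γ` and of the valuations of the
goods up to `j`, so that it can be carried out in the period of good `j`. -/
def SeqMechanism.Nonanticipating {n : ℕ} (m : SeqMechanism n) : Prop :=
  ∀ γ j, ∀ θ θ' : Fin n → ℝ, (∀ i ≤ j, θ i = θ' i) → m.q γ θ j = m.q γ θ' j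

namespace Environment

variable {n : ℕ} (E : Environment n)

/-- The set of initial types. -/
def Γ : Set ℝ := Set.Icc E.γlo E.γhi

/-- The set of valuation vectors. -/
def Θ : Set (Fin n → ℝ) := Set.Icc E.lo E.hi

/-- The law of `γ`. -/
def typeLaw : Measure ℝ := (volume.restrict E.Γ).withDensity fun γ => ENNReal.ofReal (E.g γ)

/-- The joint law of the valuations given `γ`. -/
def condLaw (γ : ℝ) : Measure (Fin n → ℝ) :=
  (volume.restrict E.Θ).withDensity fun θ => ENNReal.ofReal (E.f γ θ)

/-- The law of the valuation of good `j` given `γ`. -/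
def marginalLaw (γ : ℝ) (j : Fin n) : Measure ℝ := (E.condLaw γ).map fun θ => θ j

/-- The valuations of the different goods are independent conditional on `γ`. -/
def CondIndependent : Prop :=
  ∀ γ ∈ E.Γ, iIndepFun (fun (j : Fin n) (θ : Fin n → ℝ) => θ j) (E.condLaw γ)

/-- The distribution function `G` of `γ`. -/
def G (γ : ℝ) : ℝ := E.typeLaw.real (Set.Iic γ)

/-- The marginal distribution function `F^j(x | γ)`. -/
def marginalCDF (j : Fin n) (γ x : ℝ) : ℝ := (E.marginalLaw γ j).real (Set.Iic x)

/-- The partial derivative `F^j_γ(x | γ)` (one-sided at the end points of `Γ`). -/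
def marginalCDFDeriv (j : Fin n) (γ x : ℝ) : ℝ :=
  derivWithin (fun γ' => E.marginalCDF j γ' x) E.Γ γ

/-- The marginal density `f^j(x | γ)`: the other coordinates are integrated out. -/
def marginalDensity (j : Fin n) (γ x : ℝ) : ℝ :=
  ∫ y in Set.Icc (fun i : {i : Fin n // i ≠ j} => E.lo i) (fun i => E.hi i),
    E.f γ (fun i => if h : i = j then x else y ⟨i, h⟩)

/-- The virtual value `φ^j(γ, x) = x + (F^j_γ(x | γ) / f^j(x | γ)) (1 - G(γ)) / g(γ)`. -/
def virtualValue (j : Fin n) (γ x : ℝ) : ℝ :=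
  x + E.marginalCDFDeriv j γ x / E.marginalDensity j γ x * ((1 - E.G γ) / E.g γ)

/-- The regularity condition, marginal by marginal: `F^j_γ ≤ 0`, and the virtual value is
(weakly) increasing in `γ` and (weakly) single-crossing in `θ^j`.  Single crossing is asked for in
the interior only: `F^j_γ` vanishes at the lower end point, so the virtual value there is just
`lo j`, whatever the virtual values next to it are. -/
structure Regular : Prop where
  deriv_nonpos : ∀ j, ∀ γ ∈ E.Γ, ∀ x ∈ Set.Icc (E.lo j) (E.hi j), E.marginalCDFDeriv j γ x ≤ 0
  mono : ∀ j, ∀ x ∈ Set.Icc (E.lo j) (E.hi j), MonotoneOn (fun γ => E.virtualValue j γ x) E.Γ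
  single_crossing : ∀ j, ∀ γ ∈ E.Γ, ∀ x ∈ Set.Ioo (E.lo j) (E.hi j),
    ∀ y ∈ Set.Ioo (E.lo j) (E.hi j), x ≤ y → 0 ≤ E.virtualValue j γ x → 0 ≤ E.virtualValue j γ y

/-- Pointwise maximization of `∑ j, q^j φ^j` over `q ∈ [0,1]^n`: good `j` is sold if and only if
its virtual value is nonnegative. -/
def pointwiseRule (γ : ℝ) (θ : Fin n → ℝ) (j : Fin n) : ℝ :=
  if 0 ≤ E.virtualValue j γ (θ j) then 1 else 0

/-- The expectation over `(γ, θ)` of the pointwise maximum of `∑ j, q^j φ^j`. -/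
def pointwiseMax : ℝ :=
  ∫ γ, ∫ θ, ∑ j, max (E.virtualValue j γ (θ j)) 0 ∂(E.condLaw γ) ∂E.typeLaw

/-! ### Simultaneous selling -/

/-- Measurability, and allocation probabilities in `[0, 1]`. -/
def SimFeasible (M : SimMechanism n) : Prop :=
  Measurable (fun p : ℝ × (Fin n → ℝ) => M.q p.1 p.2) ∧ Measurable M.t₁ ∧
    Measurable (fun p : ℝ × (Fin n → ℝ) => M.t₂ p.1 p.2) ∧
    ∀ γ ∈ E.Γ, ∀ θ ∈ E.Θ, ∀ j, M.q γ θ j ∈ Set.Icc (0 : ℝ) 1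

/-- Payoff of a buyer with valuations `θ` who reported `γ'` and `θ'`. -/
def _root_.SimMechanism.payoff (M : SimMechanism n) (γ' : ℝ) (θ' θ : Fin n → ℝ) : ℝ :=
  ∑ j, M.q γ' θ' j * θ j - M.t₁ γ' - M.t₂ γ' θ'

/-- No gain from misreporting `γ`, reporting optimally afterwards. -/
def SimIC1 (M : SimMechanism n) : Prop :=
  ∀ γ ∈ E.Γ, ∀ γ' ∈ E.Γ,
    ∫ θ, (⨆ θ' : E.Θ, M.payoff γ' θ' θ) ∂(E.condLaw γ) ≤
      ∫ θ, (⨆ θ' : E.Θ, M.payoff γ θ' θ) ∂(E.condLaw γ)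

/-- No gain from misreporting `θ` after a truthful report of `γ`. -/
def SimIC2 (M : SimMechanism n) : Prop :=
  ∀ γ ∈ E.Γ, ∀ θ ∈ E.Θ, ∀ θ' ∈ E.Θ,
    ∑ j, M.q γ θ' j * θ j - M.t₂ γ θ' ≤ ∑ j, M.q γ θ j * θ j - M.t₂ γ θ

/-- Interim participation constraint. -/
def SimIR (M : SimMechanism n) : Prop :=
  ∀ γ ∈ E.Γ, 0 ≤ ∫ θ, M.payoff γ θ θ ∂(E.condLaw γ)

/-- The constraints of the simultaneous problem.  By `SimIC2`, the suprema in `SimIC1` are maxima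
attained at the true valuations, and all integrands are bounded on `Θ`. -/
def SimImplementable (M : SimMechanism n) : Prop :=
  E.SimFeasible M ∧ E.SimIC1 M ∧ E.SimIC2 M ∧ E.SimIR M

/-- Expected revenue in the simultaneous problem. -/
def simProfit (M : SimMechanism n) : ℝ :=
  ∫ γ, ∫ θ, (M.t₁ γ + M.t₂ γ θ) ∂(E.condLaw γ) ∂E.typeLaw

/-- `M` solves the simultaneous problem. -/
def SimOptimal (M : SimMechanism n) : Prop :=
  E.SimImplementable M ∧ ∀ M', E.SimImplementable M' → E.simProfit M' ≤ E.simProfit M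

/-! ### Sequential selling -/

/-- The law of the sequence of valuations in the sequential environment: the valuation of each good
is drawn, in its own period, according to the marginal law given `γ`. -/
def pathLaw (γ : ℝ) : Measure (Fin n → ℝ) := Measure.pi (E.marginalLaw γ)

/-- The same law after the valuations `θ i`, `i ≤ j`, have been drawn. -/
def contLaw (γ : ℝ) (j : Fin n) (θ : Fin n → ℝ) : Measure (Fin n → ℝ) :=
  Measure.pi fun i => if i ≤ j then Measure.dirac (θ i) else E.marginalLaw γ i

/-- A reporting strategy: the report for good `i` is a function of the valuations of the goods up
to `i`, which are all that the buyer has learned in period `i`. -/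
def IsStrategy (σ : (Fin n → ℝ) → (Fin n → ℝ)) : Prop :=
  Measurable σ ∧ (∀ θ ∈ E.Θ, σ θ ∈ E.Θ) ∧
    ∀ i, ∀ θ ∈ E.Θ, ∀ θ' ∈ E.Θ, (∀ k ≤ i, θ k = θ' k) → σ θ i = σ θ' i

/-- Measurability, and allocation probabilities in `[0, 1]`. -/
def SeqFeasible (m : SeqMechanism n) : Prop :=
  Measurable (fun p : ℝ × (Fin n → ℝ) => m.q p.1 p.2) ∧
    Measurable (fun p : ℝ × (Fin n → ℝ) => m.t p.1 p.2) ∧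
    ∀ γ ∈ E.Γ, ∀ θ ∈ E.Θ, ∀ j, m.q γ θ j ∈ Set.Icc (0 : ℝ) 1

/-- Payoff of a buyer with valuations `θ` who reported `γ'` and `θ'`. -/
def _root_.SeqMechanism.payoff (m : SeqMechanism n) (γ' : ℝ) (θ' θ : Fin n → ℝ) : ℝ :=
  ∑ j, m.q γ' θ' j * θ j - m.t γ' θ'

/-- First period: truth-telling throughout has a finite expected payoff, and no report `γ'`
followed by a reporting strategy (with a finite expected payoff) does better. -/
def SeqICInitial (m : SeqMechanism n) : Prop :=
  ∀ γ ∈ E.Γ, Integrable (fun θ => m.payoff γ θ θ) (E.pathLaw γ) ∧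
    ∀ γ' ∈ E.Γ, ∀ σ, E.IsStrategy σ →
      Integrable (fun θ => m.payoff γ' (σ θ) θ) (E.pathLaw γ) →
      ∫ θ, m.payoff γ' (σ θ) θ ∂(E.pathLaw γ) ≤ ∫ θ, m.payoff γ θ θ ∂(E.pathLaw γ)

/-- Period of good `j`: after truthful reports of `γ` and of the valuations of the goods before
`j`, and having learned the valuation of good `j`, no strategy for the reports from period `j` on
does better than the truth. -/
def SeqICLater (m : SeqMechanism n) : Prop :=
  ∀ γ ∈ E.Γ, ∀ θ ∈ E.Θ, ∀ j,
    Integrable (fun η => m.payoff γ η η) (E.contLaw γ j θ) ∧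
    ∀ σ, E.IsStrategy σ → (∀ η ∈ E.Θ, ∀ i < j, σ η i = η i) →
      Integrable (fun η => m.payoff γ (σ η) η) (E.contLaw γ j θ) →
      ∫ η, m.payoff γ (σ η) η ∂(E.contLaw γ j θ) ≤ ∫ η, m.payoff γ η η ∂(E.contLaw γ j θ)

/-- Interim participation constraint. -/
def SeqIR (m : SeqMechanism n) : Prop :=
  ∀ γ ∈ E.Γ, 0 ≤ ∫ θ, m.payoff γ θ θ ∂(E.pathLaw γ)

/-- The constraints of the sequential problem. -/
def SeqImplementable (m : SeqMechanism n) : Prop :=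
  E.SeqFeasible m ∧ E.SeqICInitial m ∧ E.SeqICLater m ∧ E.SeqIR m

/-- Expected revenue in the sequential problem. -/
def seqProfit (m : SeqMechanism n) : ℝ :=
  ∫ γ, ∫ θ, m.t γ θ ∂(E.pathLaw γ) ∂E.typeLaw

/-- `m` solves the sequential problem. -/
def SeqOptimal (m : SeqMechanism n) : Prop :=
  E.SeqImplementable m ∧ ∀ m', E.SeqImplementable m' → E.seqProfit m' ≤ E.seqProfit m

end Environment

end

/-! The upper bound comes from a coupling of types. Let T be the increasing map that carries, good
by good, the marginal law given γ' to the one given γ (`transport`). A buyer of type γ can report γ'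
and transport each valuation back before reporting it. He then behaves exactly like type γ', but
values the goods at Tθ instead of θ. Each report uses only the current valuation, so this is a
sequential strategy. With U the truthful payoff, it yields U(γ) - U(γ') ≥ E[∑ q^j(γ',θ) (Tθ^j - θ^j)
| γ'], which is `integral_mimicGain_le`. As T is Lipschitz in the type with derivative -F^j_γ/f^j at
γ = γ', U is Lipschitz and U' = E[∑ q^j (-F^j_γ/f^j)] almost everywhere (`deriv_truthPayoff`).
Integration by parts against G turns revenue into E[∑ q^j φ^j] - U(γlo) (`seqProfit_eq`). Since
U(γlo) ≥ 0, this is at most `pointwiseMax`, and equality forces the pointwise optimal allocation off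
ties and null sets.

The bound passes to simultaneous selling because a simultaneous mechanism is sequentially
implementable (`SimImplementable.net`). Its second-period constraint holds at every realization of
θ, so truth beats every reporting strategy realization by realization, and independence makes the
two laws of θ agree.

The bound is attained by posted prices that depend on γ, together with an entry fee
(`postedPrices`). Single crossing in θ^j makes the pointwise optimal rule a posted price, and
monotonicity in γ makes that price decrease in the type. The value of the option to buy at a fixed
price c has type derivative ∫_{x ≥ c} -F^j_γ dx, which is nonnegative and decreasing in c. With the
fee chosen so that truth earns the envelope payoff, decreasing prices make the report of γ incentive
compatible (`Regular.sum_optionValue_sub_le`), and the lowest type earns zero. -/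

noncomputable section

/-! ### Continuous extension of the primitives beyond Γ × Θ. -/

namespace Environment

variable {n : ℕ} (E : Environment n)

/-- The nearest point of `Γ`. -/
def clampType (γ : ℝ) : ℝ := max E.γlo (min E.γhi γ)

/-- The nearest point of `[lo j, hi j]`. -/
def clampVal (j : Fin n) (x : ℝ) : ℝ := max (E.lo j) (min (E.hi j) x)

theorem continuous_clampType : Continuous E.clampType := by
  unfold clampType; fun_prop

theorem monotone_clampType : Monotone E.clampType := fun _ _ h =>
  max_le_max le_rfl (min_le_min le_rfl h)

theorem clampType_mem (γ : ℝ) : E.clampType γ ∈ E.Γ :=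
  ⟨le_max_left _ _, max_le E.γlo_lt_γhi.le (min_le_left _ _)⟩

theorem clampType_of_mem {γ : ℝ} (h : γ ∈ E.Γ) : E.clampType γ = γ := by
  rw [clampType, min_eq_right h.2, max_eq_right h.1]

theorem continuous_clampVal (j : Fin n) : Continuous (E.clampVal j) := by
  unfold clampVal; fun_prop

theorem monotone_clampVal (j : Fin n) : Monotone (E.clampVal j) := fun _ _ h =>
  max_le_max le_rfl (min_le_min le_rfl h)

theorem clampVal_mem (j : Fin n) (x : ℝ) : E.clampVal j x ∈ Set.Icc (E.lo j) (E.hi j) :=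
  ⟨le_max_left _ _, max_le (E.lo_lt_hi j).le (min_le_left _ _)⟩

theorem clampVal_of_mem {j : Fin n} {x : ℝ} (h : x ∈ Set.Icc (E.lo j) (E.hi j)) :
    E.clampVal j x = x := by
  rw [clampVal, min_eq_right h.2, max_eq_right h.1]

theorem mem_Θ_iff {θ : Fin n → ℝ} : θ ∈ E.Θ ↔ ∀ j, θ j ∈ Set.Icc (E.lo j) (E.hi j) := by
  simp only [Θ, Set.mem_Icc, Pi.le_def, forall_and]

theorem clampBox_mem (θ : Fin n → ℝ) : (fun j => E.clampVal j (θ j)) ∈ E.Θ :=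
  E.mem_Θ_iff.2 fun j => E.clampVal_mem j _

theorem clampBox_of_mem {θ : Fin n → ℝ} (h : θ ∈ E.Θ) : (fun j => E.clampVal j (θ j)) = θ :=
  funext fun j => E.clampVal_of_mem (E.mem_Θ_iff.1 h j)

theorem measurableSet_Γ : MeasurableSet E.Γ := measurableSet_Icc

theorem measurableSet_Θ : MeasurableSet E.Θ := measurableSet_Icc

theorem γlo_mem : E.γlo ∈ E.Γ := ⟨le_rfl, E.γlo_lt_γhi.le⟩

theorem lo_mem (j : Fin n) : E.lo j ∈ Set.Icc (E.lo j) (E.hi j) := ⟨le_rfl, (E.lo_lt_hi j).le⟩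

theorem hi_mem (j : Fin n) : E.hi j ∈ Set.Icc (E.lo j) (E.hi j) := ⟨(E.lo_lt_hi j).le, le_rfl⟩

/-- The conditional density, extended continuously to all arguments. -/
def dens (γ : ℝ) (θ : Fin n → ℝ) : ℝ := E.f (E.clampType γ) fun j => E.clampVal j (θ j)

/-- The derivative of the conditional density in the type, extended continuously. -/
def densDeriv (γ : ℝ) (θ : Fin n → ℝ) : ℝ :=
  fderivWithin ℝ (fun p : ℝ × (Fin n → ℝ) => E.f p.1 p.2) (E.Γ ×ˢ E.Θ)
    (E.clampType γ, fun j => E.clampVal j (θ j)) (1, 0)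

theorem continuous_clampProd : Continuous fun p : ℝ × (Fin n → ℝ) =>
    ((E.clampType p.1, fun j => E.clampVal j (p.2 j)) : ℝ × (Fin n → ℝ)) := by
  have h1 := E.continuous_clampType
  have h2 := E.continuous_clampVal
  fun_prop

theorem clampProd_mem (p : ℝ × (Fin n → ℝ)) :
    ((E.clampType p.1, fun j => E.clampVal j (p.2 j)) : ℝ × (Fin n → ℝ)) ∈ E.Γ ×ˢ E.Θ :=
  ⟨E.clampType_mem _, E.clampBox_mem _⟩

theorem continuous_dens : Continuous fun p : ℝ × (Fin n → ℝ) => E.dens p.1 p.2 :=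
  E.contDiffOn_f.continuousOn.comp_continuous E.continuous_clampProd E.clampProd_mem

theorem uniqueDiffOn_Γ_prod_Θ : UniqueDiffOn ℝ (E.Γ ×ˢ E.Θ) := by
  refine (uniqueDiffOn_Icc E.γlo_lt_γhi).prod ?_
  rw [Θ, ← Set.pi_univ_Icc]
  exact UniqueDiffOn.pi fun j _ => uniqueDiffOn_Icc (E.lo_lt_hi j)

theorem continuous_densDeriv : Continuous fun p : ℝ × (Fin n → ℝ) => E.densDeriv p.1 p.2 := by
  have h := (E.contDiffOn_f.continuousOn_fderivWithin E.uniqueDiffOn_Γ_prod_Θ le_rfl).comp_continuous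
    E.continuous_clampProd E.clampProd_mem
  exact h.clm_apply continuous_const

theorem dens_of_mem {γ : ℝ} (hγ : γ ∈ E.Γ) {θ : Fin n → ℝ} (hθ : θ ∈ E.Θ) :
    E.dens γ θ = E.f γ θ := by
  rw [dens, E.clampType_of_mem hγ, E.clampBox_of_mem hθ]

theorem dens_pos (γ : ℝ) (θ : Fin n → ℝ) : 0 < E.dens γ θ :=
  E.f_pos _ (E.clampType_mem _) _ (E.clampBox_mem _)

/-- Chain rule along the segment with θ clamped and the type running through Γ. The segment stays in
the domain of differentiability, so only a derivative within Γ results. -/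
theorem hasDerivWithinAt_dens {γ : ℝ} (hγ : γ ∈ E.Γ) (θ : Fin n → ℝ) :
    HasDerivWithinAt (fun s => E.dens s θ) (E.densDeriv γ θ) E.Γ γ := by
  have h1 : HasFDerivWithinAt (fun p : ℝ × (Fin n → ℝ) => E.f p.1 p.2) _ (E.Γ ×ˢ E.Θ)
      (γ, fun j => E.clampVal j (θ j)) :=
    ((E.contDiffOn_f.differentiableOn one_ne_zero) _
      (show (γ, fun j => E.clampVal j (θ j)) ∈ E.Γ ×ˢ E.Θ from
        ⟨hγ, E.clampBox_mem θ⟩)).hasFDerivWithinAt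
  have h2 : HasDerivWithinAt (fun s : ℝ => ((s, fun j => E.clampVal j (θ j)) : ℝ × (Fin n → ℝ)))
      (1, 0) E.Γ γ := (hasDerivWithinAt_id _ _).prodMk (hasDerivWithinAt_const _ _ _)
  have hm : Set.MapsTo (fun s : ℝ => ((s, fun j => E.clampVal j (θ j)) : ℝ × (Fin n → ℝ))) E.Γ
      (E.Γ ×ˢ E.Θ) := fun s hs => ⟨hs, E.clampBox_mem θ⟩
  have h3 := h1.comp_hasDerivWithinAt γ h2 hm
  rw [densDeriv, E.clampType_of_mem hγ]
  refine h3.congr (fun s hs => ?_) ?_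
  · simp [dens, E.clampType_of_mem hs]
  · simp [dens, E.clampType_of_mem hγ]

theorem continuous_dens_right (γ : ℝ) : Continuous (E.dens γ) :=
  E.continuous_dens.comp (by fun_prop : Continuous fun θ : Fin n → ℝ => (γ, θ))

end Environment

/-! ### Calculus on an interval, and splitting off one coordinate. -/

/-- The fundamental theorem of calculus on an interval, between any two of its points. -/
theorem integral_eq_sub_of_hasDerivWithinAt_Icc {a b : ℝ} {u u' : ℝ → ℝ} (hu' : Continuous u')
    (h : ∀ s ∈ Set.Icc a b, HasDerivWithinAt u (u' s) (Set.Icc a b) s) {x y : ℝ}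
    (hx : x ∈ Set.Icc a b) (hy : y ∈ Set.Icc a b) : ∫ s in x..y, u' s = u y - u x := by
  wlog hxy : x ≤ y generalizing x y
  · rw [intervalIntegral.integral_symm, this hy hx (le_of_not_ge hxy), neg_sub]
  refine intervalIntegral.integral_eq_sub_of_hasDerivAt_of_le hxy ?_ ?_
    (hu'.intervalIntegrable _ _)
  · exact fun s hs => ((h s ⟨hx.1.trans hs.1, hs.2.trans hy.2⟩).continuousWithinAt).mono
      (Set.Icc_subset_Icc hx.1 hy.2)
  · exact fun s hs => (h s ⟨hx.1.trans hs.1.le, hs.2.le.trans hy.2⟩).hasDerivAt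
      (Icc_mem_nhds (hx.1.trans_lt hs.1) (hs.2.trans_le hy.2))

/-- The converse: a function whose increments are integrals of a continuous function. -/
theorem hasDerivWithinAt_of_integral_eq_sub {a b : ℝ} {u u' : ℝ → ℝ} (hu' : Continuous u') {x : ℝ}
    (h : ∀ y ∈ Set.Icc a b, u y - u x = ∫ s in x..y, u' s) :
    HasDerivWithinAt u (u' x) (Set.Icc a b) x := by
  have h1 : HasDerivAt (fun y => ∫ s in x..y, u' s) (u' x) x :=
    intervalIntegral.integral_hasDerivAt_right (hu'.intervalIntegrable _ _)
      (hu'.stronglyMeasurableAtFilter _ _) hu'.continuousAt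
  refine ((h1.const_add (u x)).hasDerivWithinAt).congr (fun y hy => ?_) (by simp)
  rw [← h y hy]; ring

/-- Swapping an integral over a compact set and an interval integral. -/
theorem intervalIntegral_setIntegral_swap {α : Type*} [TopologicalSpace α] [MeasurableSpace α]
    [OpensMeasurableSpace α] [T2Space α] [SecondCountableTopology α] {μ : Measure α} [SFinite μ]
    [IsFiniteMeasureOnCompacts μ] {h : ℝ → α → ℝ} (hh : Continuous (Function.uncurry h))
    {s : Set α} (hs : IsCompact s) (a b : ℝ) :
    ∫ x in a..b, (∫ y in s, h x y ∂μ) = ∫ y in s, (∫ x in a..b, h x y) ∂μ := by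
  refine intervalIntegral_integral_swap ?_
  rw [Measure.prod_restrict]
  have : IntegrableOn (Function.uncurry h) (Set.uIcc a b ×ˢ s) (volume.prod μ) :=
    hh.continuousOn.integrableOn_compact (isCompact_uIcc.prod hs)
  exact this.mono_set (Set.prod_mono Set.uIoc_subset_uIcc subset_rfl)

/-- The vector with entry `x` in place `j` and the entries of `y` elsewhere. -/
def insertCoord {n : ℕ} (j : Fin n) (x : ℝ) (y : {i : Fin n // i ≠ j} → ℝ) : Fin n → ℝ :=
  fun i => if h : i = j then x else y ⟨i, h⟩

theorem insertCoord_self {n : ℕ} (j : Fin n) (x : ℝ) (y : {i : Fin n // i ≠ j} → ℝ) :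
    insertCoord j x y j = x := by simp [insertCoord]

theorem continuous_insertCoord {n : ℕ} (j : Fin n) :
    Continuous fun p : ℝ × ({i : Fin n // i ≠ j} → ℝ) => insertCoord j p.1 p.2 := by
  refine continuous_pi fun i => ?_
  by_cases h : i = j
  · simp only [insertCoord, h, dite_true]; fun_prop
  · simp only [insertCoord, h, dite_false]; fun_prop

/-- Volume factors over the singleton index set {j} and its complement, and the singleton factor is
the line itself. This lets Tonelli integrate out the other valuations. -/
theorem measurePreserving_insertCoord {n : ℕ} (j : Fin n) :
    MeasurePreserving (fun p : ℝ × ({i : Fin n // i ≠ j} → ℝ) => insertCoord j p.1 p.2)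
      ((volume : Measure ℝ).prod volume) volume := by
  have h1 := (volume_preserving_piEquivPiSubtypeProd (fun _ : Fin n => ℝ) (fun i => i = j)).symm
  rw [Measure.volume_eq_prod] at h1
  have h2 := ((@volume_preserving_piUnique {i : Fin n // i = j} (Subtype.fintype _)
    (fun _ => ℝ) _ _).symm).prod
    (MeasurePreserving.id (volume : Measure ({i : Fin n // ¬ i = j} → ℝ)))
  have h3 : (fun p : ℝ × ({i : Fin n // i ≠ j} → ℝ) => insertCoord j p.1 p.2) =
      (MeasurableEquiv.piEquivPiSubtypeProd (fun _ : Fin n => ℝ) (fun i => i = j)).symm ∘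
        Prod.map (MeasurableEquiv.piUnique fun _ : {i : Fin n // i = j} => ℝ).symm id := rfl
  rw [h3]
  exact h1.comp h2

theorem insertCoord_mem_Icc {n : ℕ} (j : Fin n) (lo hi : Fin n → ℝ) (x : ℝ)
    (y : {i : Fin n // i ≠ j} → ℝ) :
    insertCoord j x y ∈ Set.Icc lo hi ↔
      x ∈ Set.Icc (lo j) (hi j) ∧
        y ∈ Set.Icc (fun i : {i : Fin n // i ≠ j} => lo i) (fun i => hi i) := by
  simp only [Set.mem_Icc, Pi.le_def, insertCoord]
  constructor
  · rintro ⟨h1, h2⟩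
    exact ⟨⟨by simpa using h1 j, by simpa using h2 j⟩,
      fun i => by simpa [i.2] using h1 i, fun i => by simpa [i.2] using h2 i⟩
  · rintro ⟨⟨h1, h2⟩, h3, h4⟩
    constructor
    · intro i
      by_cases h : i = j
      · subst h; simpa using h1
      · simpa [h] using h3 ⟨i, h⟩
    · intro i
      by_cases h : i = j
      · subst h; simpa using h2
      · simpa [h] using h4 ⟨i, h⟩

/-! ### Marginal densities, marginal laws and distribution functions. -/

namespace Environment

variable {n : ℕ} (E : Environment n)

/-- The box of the valuations of the goods other than `j`. -/
def others (j : Fin n) : Set ({i : Fin n // i ≠ j} → ℝ) :=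
  Set.Icc (fun i => E.lo i) (fun i => E.hi i)

theorem measurableSet_others (j : Fin n) : MeasurableSet (E.others j) := measurableSet_Icc

theorem isCompact_others (j : Fin n) : IsCompact (E.others j) := isCompact_Icc

/-- The marginal density, extended continuously. -/
def mdens (j : Fin n) (γ x : ℝ) : ℝ := ∫ y in E.others j, E.dens γ (insertCoord j x y)

/-- The derivative of the marginal density in the type, extended continuously. -/
def mdensDeriv (j : Fin n) (γ x : ℝ) : ℝ := ∫ y in E.others j, E.densDeriv γ (insertCoord j x y)

theorem continuous_mdens (j : Fin n) : Continuous fun p : ℝ × ℝ => E.mdens j p.1 p.2 := by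
  have h : Continuous (Function.uncurry fun (p : ℝ × ℝ) (y : {i : Fin n // i ≠ j} → ℝ) =>
      E.dens p.1 (insertCoord j p.2 y)) :=
    E.continuous_dens.comp ((continuous_fst.comp continuous_fst).prodMk
      ((continuous_insertCoord j).comp
        ((continuous_snd.comp continuous_fst).prodMk continuous_snd)))
  exact continuous_parametric_integral_of_continuous h (E.isCompact_others j)

theorem continuous_mdensDeriv (j : Fin n) : Continuous fun p : ℝ × ℝ => E.mdensDeriv j p.1 p.2 := by
  have h : Continuous (Function.uncurry fun (p : ℝ × ℝ) (y : {i : Fin n // i ≠ j} → ℝ) =>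
      E.densDeriv p.1 (insertCoord j p.2 y)) :=
    E.continuous_densDeriv.comp ((continuous_fst.comp continuous_fst).prodMk
      ((continuous_insertCoord j).comp
        ((continuous_snd.comp continuous_fst).prodMk continuous_snd)))
  exact continuous_parametric_integral_of_continuous h (E.isCompact_others j)

theorem continuous_mdens_right (j : Fin n) (γ : ℝ) : Continuous (E.mdens j γ) :=
  (E.continuous_mdens j).comp (by fun_prop : Continuous fun x : ℝ => (γ, x))

theorem continuous_mdensDeriv_right (j : Fin n) (γ : ℝ) : Continuous (E.mdensDeriv j γ) :=
  (E.continuous_mdensDeriv j).comp (by fun_prop : Continuous fun x : ℝ => (γ, x))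

theorem continuous_insertCoord_right (j : Fin n) (x : ℝ) : Continuous (insertCoord j x) :=
  (continuous_insertCoord j).comp
    (by fun_prop : Continuous fun y : {i : Fin n // i ≠ j} → ℝ => (x, y))

theorem integrableOn_dens_insertCoord (j : Fin n) (γ x : ℝ) :
    IntegrableOn (fun y => E.dens γ (insertCoord j x y)) (E.others j) :=
  ((E.continuous_dens_right γ).comp
    (continuous_insertCoord_right j x)).continuousOn.integrableOn_compact (E.isCompact_others j)

/-- Clamping keeps the density positive at every argument, so positivity holds also outside the box,
where the distribution functions need it to be globally invertible. -/
theorem mdens_pos (j : Fin n) (γ x : ℝ) : 0 < E.mdens j γ x := by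
  refine (integral_pos_iff_support_of_nonneg (fun y => (E.dens_pos _ _).le)
    (E.integrableOn_dens_insertCoord j γ x)).2 ?_
  have : Function.support (fun y => E.dens γ (insertCoord j x y)) = Set.univ :=
    Set.eq_univ_of_forall fun y => (E.dens_pos _ _).ne'
  rw [this, Measure.restrict_apply_univ, others, Real.volume_Icc_pi]
  refine pos_iff_ne_zero.2 (Finset.prod_ne_zero_iff.2 fun i _ => ?_)
  simpa using E.lo_lt_hi i

theorem mdens_eq_marginalDensity (j : Fin n) {γ x : ℝ} (hγ : γ ∈ E.Γ)
    (hx : x ∈ Set.Icc (E.lo j) (E.hi j)) : E.marginalDensity j γ x = E.mdens j γ x := by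
  refine setIntegral_congr_fun measurableSet_Icc fun y hy => ?_
  exact (E.dens_of_mem hγ ((insertCoord_mem_Icc j _ _ _ _).2 ⟨hx, hy⟩)).symm

/-- Differentiation under the integral in integrated form: the fundamental theorem of calculus for
each fixed vector of other valuations, followed by Fubini. Only continuity of `densDeriv` is needed.
-/
theorem mdens_sub (j : Fin n) {γ γ' : ℝ} (hγ : γ ∈ E.Γ) (hγ' : γ' ∈ E.Γ) (x : ℝ) :
    ∫ s in γ..γ', E.mdensDeriv j s x = E.mdens j γ' x - E.mdens j γ x := by
  have hc : Continuous (Function.uncurry fun (s : ℝ) (y : {i : Fin n // i ≠ j} → ℝ) =>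
      E.densDeriv s (insertCoord j x y)) :=
    E.continuous_densDeriv.comp (continuous_fst.prodMk
      ((continuous_insertCoord_right j x).comp continuous_snd))
  unfold mdensDeriv mdens
  rw [intervalIntegral_setIntegral_swap hc (E.isCompact_others j),
    ← integral_sub (E.integrableOn_dens_insertCoord j γ' x) (E.integrableOn_dens_insertCoord j γ x)]
  congr 1
  ext y
  exact integral_eq_sub_of_hasDerivWithinAt_Icc (u := fun s => E.dens s (insertCoord j x y))
    (u' := fun s => E.densDeriv s (insertCoord j x y))
    (hc.comp (by fun_prop : Continuous fun s : ℝ => (s, y)))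
    (fun s hs => E.hasDerivWithinAt_dens hs _) hγ hγ'

theorem condLaw_eq {γ : ℝ} (hγ : γ ∈ E.Γ) :
    E.condLaw γ = (volume.restrict E.Θ).withDensity fun θ => ENNReal.ofReal (E.dens γ θ) := by
  refine withDensity_congr_ae ?_
  filter_upwards [ae_restrict_mem E.measurableSet_Θ] with θ hθ
  rw [E.dens_of_mem hγ hθ]

theorem integrableOn_dens (γ : ℝ) : IntegrableOn (E.dens γ) E.Θ :=
  (E.continuous_dens_right γ).continuousOn.integrableOn_compact isCompact_Icc

theorem integral_dens {γ : ℝ} (hγ : γ ∈ E.Γ) : ∫ θ in E.Θ, E.dens γ θ = 1 := by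
  rw [← E.integral_f γ hγ]
  exact setIntegral_congr_fun E.measurableSet_Θ fun θ hθ => E.dens_of_mem hγ hθ

theorem isProbabilityMeasure_condLaw {γ : ℝ} (hγ : γ ∈ E.Γ) :
    IsProbabilityMeasure (E.condLaw γ) := by
  constructor
  rw [E.condLaw_eq hγ, withDensity_apply _ MeasurableSet.univ, Measure.restrict_univ,
    ← ofReal_integral_eq_lintegral_ofReal (E.integrableOn_dens γ)
      (Filter.Eventually.of_forall fun θ => (E.dens_pos _ _).le), E.integral_dens hγ,
    ENNReal.ofReal_one]

theorem measurable_ofReal_dens (γ : ℝ) : Measurable fun θ => ENNReal.ofReal (E.dens γ θ) :=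
  (E.continuous_dens_right γ).measurable.ennreal_ofReal

theorem marginalLaw_eq (j : Fin n) {γ : ℝ} (hγ : γ ∈ E.Γ) :
    E.marginalLaw γ j = (volume.restrict (Set.Icc (E.lo j) (E.hi j))).withDensity
      fun x => ENNReal.ofReal (E.mdens j γ x) := by
  ext s hs
  have hK := (E.measurable_ofReal_dens γ).indicator
    ((measurable_pi_apply (X := fun _ : Fin n => ℝ) j hs).inter E.measurableSet_Θ)
  rw [marginalLaw, Measure.map_apply (measurable_pi_apply j) hs, E.condLaw_eq hγ,
    withDensity_apply _ (measurable_pi_apply j hs), withDensity_apply _ hs,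
    Measure.restrict_restrict hs, Measure.restrict_restrict (measurable_pi_apply j hs),
    ← lintegral_indicator ((measurable_pi_apply j hs).inter E.measurableSet_Θ),
    ← lintegral_indicator (hs.inter measurableSet_Icc),
    ← (measurePreserving_insertCoord j).lintegral_comp hK]
  refine (lintegral_prod _ (hK.comp (continuous_insertCoord j).measurable).aemeasurable).trans ?_
  congr 1
  ext x
  by_cases hx : x ∈ s ∩ Set.Icc (E.lo j) (E.hi j)
  · rw [Set.indicator_of_mem hx, mdens, ofReal_integral_eq_lintegral_ofReal
      (E.integrableOn_dens_insertCoord j γ x)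
      (Filter.Eventually.of_forall fun θ => (E.dens_pos _ _).le),
      ← lintegral_indicator (E.measurableSet_others j)]
    congr 1
    ext y
    simp only [Function.comp_apply]
    by_cases hy : y ∈ E.others j
    · rw [Set.indicator_of_mem hy, Set.indicator_of_mem]
      refine ⟨?_, (insertCoord_mem_Icc j _ _ _ _).2 ⟨hx.2, hy⟩⟩
      simpa [insertCoord_self] using hx.1
    · rw [Set.indicator_of_notMem hy, Set.indicator_of_notMem]
      exact fun h => hy ((insertCoord_mem_Icc j _ _ _ _).1 h.2).2
  · rw [Set.indicator_of_notMem hx]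
    refine lintegral_eq_zero_of_ae_eq_zero (Filter.Eventually.of_forall fun y => ?_)
    refine Set.indicator_of_notMem (fun h => hx ⟨?_, ((insertCoord_mem_Icc j _ _ _ _).1 h.2).1⟩) _
    simpa [insertCoord_self] using h.1

theorem isProbabilityMeasure_marginalLaw (j : Fin n) {γ : ℝ} (hγ : γ ∈ E.Γ) :
    IsProbabilityMeasure (E.marginalLaw γ j) := by
  have := E.isProbabilityMeasure_condLaw hγ
  exact Measure.isProbabilityMeasure_map (measurable_pi_apply j).aemeasurable

/-- The marginal distribution function, in terms of the density. -/
def cdf (j : Fin n) (γ x : ℝ) : ℝ := ∫ u in E.lo j..x, E.mdens j γ u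

/-- The derivative of the marginal distribution function in the type. -/
def cdfDeriv (j : Fin n) (γ x : ℝ) : ℝ := ∫ u in E.lo j..x, E.mdensDeriv j γ u

theorem continuous_cdf (j : Fin n) : Continuous fun p : ℝ × ℝ => E.cdf j p.1 p.2 := by
  have h : Continuous (Function.uncurry fun (p : ℝ × ℝ) (u : ℝ) => E.mdens j p.1 u) :=
    (E.continuous_mdens j).comp ((continuous_fst.comp continuous_fst).prodMk continuous_snd)
  exact intervalIntegral.continuous_parametric_intervalIntegral_of_continuous h continuous_snd

theorem continuous_cdfDeriv (j : Fin n) : Continuous fun p : ℝ × ℝ => E.cdfDeriv j p.1 p.2 := by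
  have h : Continuous (Function.uncurry fun (p : ℝ × ℝ) (u : ℝ) => E.mdensDeriv j p.1 u) :=
    (E.continuous_mdensDeriv j).comp ((continuous_fst.comp continuous_fst).prodMk continuous_snd)
  exact intervalIntegral.continuous_parametric_intervalIntegral_of_continuous h continuous_snd

theorem hasDerivAt_cdf (j : Fin n) (γ x : ℝ) :
    HasDerivAt (E.cdf j γ) (E.mdens j γ x) x :=
  intervalIntegral.integral_hasDerivAt_right ((E.continuous_mdens_right j γ).intervalIntegrable _ _)
    ((E.continuous_mdens_right j γ).stronglyMeasurableAtFilter _ _)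
    (E.continuous_mdens_right j γ).continuousAt

theorem hasDerivAt_cdfDeriv (j : Fin n) (γ x : ℝ) :
    HasDerivAt (E.cdfDeriv j γ) (E.mdensDeriv j γ x) x :=
  intervalIntegral.integral_hasDerivAt_right
    ((E.continuous_mdensDeriv_right j γ).intervalIntegrable _ _)
    ((E.continuous_mdensDeriv_right j γ).stronglyMeasurableAtFilter _ _)
    (E.continuous_mdensDeriv_right j γ).continuousAt

/-- Strictness on the whole line is what later allows two valuations to be compared, or identified,
through their values of the distribution function. -/
theorem strictMono_cdf (j : Fin n) (γ : ℝ) : StrictMono (E.cdf j γ) :=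
  strictMono_of_hasDerivAt_pos (fun x => E.hasDerivAt_cdf j γ x) fun x => E.mdens_pos j γ x

theorem cdf_lo (j : Fin n) (γ : ℝ) : E.cdf j γ (E.lo j) = 0 := by simp [cdf]

theorem cdfDeriv_lo (j : Fin n) (γ : ℝ) : E.cdfDeriv j γ (E.lo j) = 0 := by simp [cdfDeriv]

theorem marginalLaw_Iic (j : Fin n) {γ : ℝ} (hγ : γ ∈ E.Γ) {x : ℝ}
    (hx : x ∈ Set.Icc (E.lo j) (E.hi j)) :
    E.marginalLaw γ j (Set.Iic x) = ENNReal.ofReal (E.cdf j γ x) := by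
  have : Set.Iic x ∩ Set.Icc (E.lo j) (E.hi j) = Set.Icc (E.lo j) x := by
    ext y; simp only [Set.mem_inter_iff, Set.mem_Iic, Set.mem_Icc]
    exact ⟨fun h => ⟨h.2.1, h.1⟩, fun h => ⟨h.2, h.1, h.2.trans hx.2⟩⟩
  rw [E.marginalLaw_eq j hγ, withDensity_apply _ measurableSet_Iic,
    Measure.restrict_restrict measurableSet_Iic, this, cdf,
    intervalIntegral.integral_of_le hx.1, ← integral_Icc_eq_integral_Ioc,
    ofReal_integral_eq_lintegral_ofReal _
      (Filter.Eventually.of_forall fun u => (E.mdens_pos j γ u).le)]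
  exact (E.continuous_mdens_right j γ).continuousOn.integrableOn_compact isCompact_Icc

theorem cdf_nonneg (j : Fin n) (γ : ℝ) {x : ℝ} (hx : E.lo j ≤ x) : 0 ≤ E.cdf j γ x := by
  rw [← E.cdf_lo j γ]; exact (E.strictMono_cdf j γ).monotone hx

theorem marginalCDF_eq (j : Fin n) {γ : ℝ} (hγ : γ ∈ E.Γ) {x : ℝ}
    (hx : x ∈ Set.Icc (E.lo j) (E.hi j)) : E.marginalCDF j γ x = E.cdf j γ x := by
  rw [marginalCDF, Measure.real, E.marginalLaw_Iic j hγ hx,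
    ENNReal.toReal_ofReal (E.cdf_nonneg j γ hx.1)]

theorem ae_marginalLaw_mem (j : Fin n) {γ : ℝ} (hγ : γ ∈ E.Γ) :
    ∀ᵐ x ∂(E.marginalLaw γ j), x ∈ Set.Icc (E.lo j) (E.hi j) := by
  rw [E.marginalLaw_eq j hγ]
  exact (withDensity_absolutelyContinuous _ _).ae_le (ae_restrict_mem measurableSet_Icc)

theorem cdf_hi (j : Fin n) {γ : ℝ} (hγ : γ ∈ E.Γ) : E.cdf j γ (E.hi j) = 1 := by
  have := E.isProbabilityMeasure_marginalLaw j hγ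
  have h1 : E.marginalLaw γ j (Set.Iic (E.hi j)) = 1 := by
    rw [← measure_univ (μ := E.marginalLaw γ j)]
    refine measure_congr ?_
    filter_upwards [E.ae_marginalLaw_mem j hγ] with x hx
    exact propext ⟨fun _ => trivial, fun _ => hx.2⟩
  rw [← E.marginalCDF_eq j hγ (E.hi_mem j), marginalCDF, Measure.real, h1, ENNReal.toReal_one]

theorem cdf_sub (j : Fin n) {γ γ' : ℝ} (hγ : γ ∈ E.Γ) (hγ' : γ' ∈ E.Γ) (x : ℝ) :
    E.cdf j γ' x - E.cdf j γ x = ∫ s in γ..γ', E.cdfDeriv j s x := by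
  have hi := fun γ => (E.continuous_mdens_right j γ).intervalIntegrable (μ := volume) (E.lo j) x
  unfold cdf cdfDeriv
  rw [← intervalIntegral.integral_sub (hi _) (hi _)]
  simp_rw [← E.mdens_sub j hγ hγ']
  have hc : Continuous (Function.uncurry fun s u : ℝ => E.mdensDeriv j s u) :=
    E.continuous_mdensDeriv j
  simp_rw [intervalIntegral.intervalIntegral_eq_integral_uIoc _ (E.lo j) x]
  rw [intervalIntegral.integral_smul]
  congr 1
  symm
  refine intervalIntegral_integral_swap ?_
  rw [Measure.prod_restrict]
  have : IntegrableOn (Function.uncurry fun s u : ℝ => E.mdensDeriv j s u)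
      (Set.uIcc γ γ' ×ˢ Set.uIcc (E.lo j) x) (volume.prod volume) :=
    hc.continuousOn.integrableOn_compact (isCompact_uIcc.prod isCompact_uIcc)
  exact this.mono_set (Set.prod_mono Set.uIoc_subset_uIcc Set.uIoc_subset_uIcc)

theorem continuous_cdfDeriv_left (j : Fin n) (x : ℝ) : Continuous fun s => E.cdfDeriv j s x :=
  (E.continuous_cdfDeriv j).comp (by fun_prop : Continuous fun s : ℝ => (s, x))

theorem continuous_cdfDeriv_right (j : Fin n) (γ : ℝ) : Continuous (E.cdfDeriv j γ) :=
  (E.continuous_cdfDeriv j).comp (by fun_prop : Continuous fun x : ℝ => (γ, x))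

theorem hasDerivWithinAt_cdf (j : Fin n) {γ : ℝ} (hγ : γ ∈ E.Γ) (x : ℝ) :
    HasDerivWithinAt (fun s => E.cdf j s x) (E.cdfDeriv j γ x) E.Γ γ :=
  hasDerivWithinAt_of_integral_eq_sub (E.continuous_cdfDeriv_left j x)
    fun _ hy => E.cdf_sub j hγ hy x

theorem uniqueDiffWithinAt_Γ {γ : ℝ} (hγ : γ ∈ E.Γ) : UniqueDiffWithinAt ℝ E.Γ γ :=
  uniqueDiffOn_Icc E.γlo_lt_γhi γ hγ

theorem marginalCDFDeriv_eq (j : Fin n) {γ : ℝ} (hγ : γ ∈ E.Γ) {x : ℝ}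
    (hx : x ∈ Set.Icc (E.lo j) (E.hi j)) : E.marginalCDFDeriv j γ x = E.cdfDeriv j γ x := by
  refine HasDerivWithinAt.derivWithin ?_ (E.uniqueDiffWithinAt_Γ hγ)
  exact (E.hasDerivWithinAt_cdf j hγ x).congr (fun s hs => E.marginalCDF_eq j hs hx)
    (E.marginalCDF_eq j hγ hx)

/-- At the upper end point the distribution function is 1 for every type. Together with
`cdfDeriv_lo` this kills the boundary terms when integrating by parts in the valuation. -/
theorem cdfDeriv_hi (j : Fin n) {γ : ℝ} (hγ : γ ∈ E.Γ) : E.cdfDeriv j γ (E.hi j) = 0 := by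
  refine (E.uniqueDiffWithinAt_Γ hγ).eq_deriv _ (E.hasDerivWithinAt_cdf j hγ (E.hi j)) ?_
  exact (hasDerivWithinAt_const γ E.Γ (1 : ℝ)).congr (fun s hs => E.cdf_hi j hs) (E.cdf_hi j hγ)

end Environment

/-! ### The monotone coupling of the marginals of two types. -/

namespace Environment

variable {n : ℕ} (E : Environment n)

/-- The valuation at which the marginal distribution function given `γ` takes the value that it
has at `x` given `γ'`. -/
def transport (j : Fin n) (γ' γ x : ℝ) : ℝ :=
  Function.invFun (E.cdf j γ) (E.cdf j γ' (E.clampVal j x))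

theorem continuous_cdf_right (j : Fin n) (γ : ℝ) : Continuous (E.cdf j γ) :=
  (E.continuous_cdf j).comp (by fun_prop : Continuous fun x : ℝ => (γ, x))

/-- Clamping the argument puts the level in [0, 1], which the distribution function covers on `[lo
j, hi j]`; so `Function.invFun` returns a genuine preimage and not its default value. -/
theorem cdf_transport (j : Fin n) {γ' γ : ℝ} (hγ' : γ' ∈ E.Γ) (hγ : γ ∈ E.Γ) (x : ℝ) :
    E.cdf j γ (E.transport j γ' γ x) = E.cdf j γ' (E.clampVal j x) := by
  refine Function.invFun_eq ?_
  have h := intermediate_value_Icc (E.lo_lt_hi j).le (E.continuous_cdf_right j γ).continuousOn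
  rw [E.cdf_lo, E.cdf_hi j hγ] at h
  obtain ⟨y, -, hy⟩ := h ⟨E.cdf_nonneg j γ' (E.clampVal_mem j x).1, by
    rw [← E.cdf_hi j hγ']; exact (E.strictMono_cdf j γ').monotone (E.clampVal_mem j x).2⟩
  exact ⟨y, hy⟩

theorem transport_mem (j : Fin n) {γ' γ : ℝ} (hγ' : γ' ∈ E.Γ) (hγ : γ ∈ E.Γ) (x : ℝ) :
    E.transport j γ' γ x ∈ Set.Icc (E.lo j) (E.hi j) := by
  have h := E.cdf_transport j hγ' hγ x
  constructor
  · rw [← (E.strictMono_cdf j γ).le_iff_le, h, E.cdf_lo]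
    exact E.cdf_nonneg j γ' (E.clampVal_mem j x).1
  · rw [← (E.strictMono_cdf j γ).le_iff_le, h, E.cdf_hi j hγ, ← E.cdf_hi j hγ']
    exact (E.strictMono_cdf j γ').monotone (E.clampVal_mem j x).2

theorem monotone_transport (j : Fin n) {γ' γ : ℝ} (hγ' : γ' ∈ E.Γ) (hγ : γ ∈ E.Γ) :
    Monotone (E.transport j γ' γ) := fun x y hxy => by
  rw [← (E.strictMono_cdf j γ).le_iff_le, E.cdf_transport j hγ' hγ, E.cdf_transport j hγ' hγ]
  exact (E.strictMono_cdf j γ').monotone (E.monotone_clampVal j hxy)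

theorem transport_transport (j : Fin n) {γ₁ γ₂ γ₃ : ℝ} (h₁ : γ₁ ∈ E.Γ) (h₂ : γ₂ ∈ E.Γ)
    (h₃ : γ₃ ∈ E.Γ) (x : ℝ) :
    E.transport j γ₂ γ₃ (E.transport j γ₁ γ₂ x) = E.transport j γ₁ γ₃ x := by
  apply (E.strictMono_cdf j γ₃).injective
  rw [E.cdf_transport j h₂ h₃, E.clampVal_of_mem (E.transport_mem j h₁ h₂ x),
    E.cdf_transport j h₁ h₂, E.cdf_transport j h₁ h₃]

theorem transport_self (j : Fin n) {γ x : ℝ} (hγ : γ ∈ E.Γ)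
    (hx : x ∈ Set.Icc (E.lo j) (E.hi j)) : E.transport j γ γ x = x := by
  apply (E.strictMono_cdf j γ).injective
  rw [E.cdf_transport j hγ hγ, E.clampVal_of_mem hx]

theorem marginalLaw_Iic_clampVal (j : Fin n) {γ : ℝ} (hγ : γ ∈ E.Γ) {a : ℝ} (ha : E.lo j ≤ a) :
    E.marginalLaw γ j (Set.Iic a) = ENNReal.ofReal (E.cdf j γ (E.clampVal j a)) := by
  rw [← E.marginalLaw_Iic j hγ (E.clampVal_mem j a)]
  refine measure_congr ?_
  filter_upwards [E.ae_marginalLaw_mem j hγ] with x hx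
  refine propext ⟨fun h => ?_, fun h => ?_⟩
  · exact le_max_of_le_right (le_min hx.2 h)
  · refine le_trans (show x ≤ _ from h) (max_le ha (min_le_right _ _))

/-- The transports between two types are adjoint: one sends x below a exactly if x lies below the
image of a under the other. So preimages of half-lines are half-lines, up to null sets, with the
right mass. Below `lo j` both measures vanish. -/
theorem map_transport (j : Fin n) {γ' γ : ℝ} (hγ' : γ' ∈ E.Γ) (hγ : γ ∈ E.Γ) :
    (E.marginalLaw γ' j).map (E.transport j γ' γ) = E.marginalLaw γ j := by
  have := E.isProbabilityMeasure_marginalLaw j hγ'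
  have := E.isProbabilityMeasure_marginalLaw j hγ
  have hm := (E.monotone_transport j hγ' hγ).measurable
  have := Measure.isProbabilityMeasure_map hm.aemeasurable (μ := E.marginalLaw γ' j)
  refine Measure.ext_of_Iic _ _ fun a => ?_
  rw [Measure.map_apply hm measurableSet_Iic]
  by_cases ha : E.lo j ≤ a
  · rw [E.marginalLaw_Iic_clampVal j hγ ha, ← E.cdf_transport j hγ hγ',
      ← E.marginalLaw_Iic j hγ' (E.transport_mem j hγ hγ' a)]
    refine measure_congr ?_
    filter_upwards [E.ae_marginalLaw_mem j hγ'] with x hx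
    refine propext ?_
    change E.transport j γ' γ x ≤ a ↔ x ≤ E.transport j γ γ' a
    have h1 : x ≤ E.transport j γ γ' a ↔ E.transport j γ' γ x ≤ E.clampVal j a := by
      rw [iff_comm, ← (E.strictMono_cdf j γ).le_iff_le, E.cdf_transport j hγ' hγ,
        E.clampVal_of_mem hx, ← E.cdf_transport j hγ hγ', (E.strictMono_cdf j γ').le_iff_le]
    rw [h1]
    have hT := E.transport_mem j hγ' hγ x
    exact ⟨fun h => le_max_of_le_right (le_min hT.2 h),
      fun h => h.trans (max_le ha (min_le_right _ _))⟩
  · have h1 : E.marginalLaw γ j (Set.Iic a) = 0 := by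
      refine measure_mono_null ?_ (E.ae_marginalLaw_mem j hγ)
      intro x hx h
      exact ha (h.1.trans hx)
    have h2 : (E.transport j γ' γ) ⁻¹' Set.Iic a = ∅ := by
      refine Set.eq_empty_of_forall_notMem fun x hx => ha ?_
      exact (E.transport_mem j hγ' hγ x).1.trans hx
    rw [h1, h2, measure_empty]

theorem exists_cdf_sub_eq (j : Fin n) (γ x y : ℝ) :
    ∃ ξ ∈ Set.uIcc x y, E.cdf j γ y - E.cdf j γ x = E.mdens j γ ξ * (y - x) := by
  wlog hxy : x ≤ y generalizing x y
  · obtain ⟨ξ, h1, h2⟩ := this y x (le_of_not_ge hxy)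
    exact ⟨ξ, Set.uIcc_comm x y ▸ h1, by linarith⟩
  rcases hxy.eq_or_lt with rfl | hlt
  · exact ⟨x, by simp, by simp⟩
  · obtain ⟨ξ, h1, h2⟩ := exists_hasDerivAt_eq_slope (E.cdf j γ) (E.mdens j γ) hlt
      (E.continuous_cdf_right j γ).continuousOn fun x _ => E.hasDerivAt_cdf j γ x
    refine ⟨ξ, Set.Icc_subset_uIcc (Set.Ioo_subset_Icc_self h1), ?_⟩
    rw [h2, div_mul_cancel₀ _ (sub_pos.2 hlt).ne']

/-- Write T for the transport from γ' to γ. By the mean value theorem f(ξ)(Tx - x) = F(Tx|γ) -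
F(x|γ) = F(x|γ') - F(x|γ). The right side is at most max |F_γ| times |γ - γ'|, and the density is
bounded below on the compact domain. -/
theorem exists_transport_lipschitz : ∃ L : ℝ, 0 ≤ L ∧ ∀ j, ∀ γ' ∈ E.Γ, ∀ γ ∈ E.Γ,
    ∀ x ∈ Set.Icc (E.lo j) (E.hi j), |E.transport j γ' γ x - x| ≤ L * |γ - γ'| := by
  have key : ∀ j, ∃ L : ℝ, 0 ≤ L ∧ ∀ γ' ∈ E.Γ, ∀ γ ∈ E.Γ,
      ∀ x ∈ Set.Icc (E.lo j) (E.hi j), |E.transport j γ' γ x - x| ≤ L * |γ - γ'| := by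
    intro j
    have hc : IsCompact (E.Γ ×ˢ Set.Icc (E.lo j) (E.hi j)) := isCompact_Icc.prod isCompact_Icc
    obtain ⟨p, hp, hmin⟩ := hc.exists_isMinOn ⟨(E.γlo, E.lo j), E.γlo_mem, E.lo_mem j⟩
      (E.continuous_mdens j).continuousOn
    obtain ⟨C, hC⟩ := hc.exists_bound_of_continuousOn (E.continuous_cdfDeriv j).continuousOn
    have hC0 : 0 ≤ C := (norm_nonneg _).trans (hC (E.γlo, E.lo j) ⟨E.γlo_mem, E.lo_mem j⟩)
    have hm := E.mdens_pos j p.1 p.2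
    refine ⟨C / E.mdens j p.1 p.2, by positivity, fun γ' hγ' γ hγ x hx => ?_⟩
    have hT := E.transport_mem j hγ' hγ x
    obtain ⟨ξ, hξ, h⟩ := E.exists_cdf_sub_eq j γ x (E.transport j γ' γ x)
    rw [E.cdf_transport j hγ' hγ, E.clampVal_of_mem hx] at h
    have h1 : E.mdens j p.1 p.2 ≤ E.mdens j γ ξ :=
      hmin (show (γ, ξ) ∈ _ from ⟨hγ, Set.uIcc_subset_Icc hx hT hξ⟩)
    have h2 : |E.cdf j γ' x - E.cdf j γ x| ≤ C * |γ' - γ| := by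
      rw [E.cdf_sub j hγ hγ']
      refine intervalIntegral.norm_integral_le_of_norm_le_const fun s hs => hC (s, x) ⟨?_, hx⟩
      exact Set.uIcc_subset_Icc hγ hγ' (Set.uIoc_subset_uIcc hs)
    rw [h, abs_mul, abs_of_pos (E.mdens_pos _ _ _)] at h2
    rw [div_mul_eq_mul_div, le_div_iff₀ hm, abs_sub_comm γ γ', mul_comm]
    exact (mul_le_mul_of_nonneg_right h1 (abs_nonneg _)).trans h2
  choose L hL0 hL using key
  -- The sum of the constants serves all goods at once, and is 0 when there are none.
  refine ⟨∑ j, L j, Finset.sum_nonneg fun j _ => hL0 j, fun j γ' hγ' γ hγ x hx =>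
    (hL j γ' hγ' γ hγ x hx).trans (mul_le_mul_of_nonneg_right ?_ (abs_nonneg _))⟩
  exact Finset.single_le_sum (fun j _ => hL0 j) (Finset.mem_univ j)

-- The same mean value identity shows that the difference quotient of the transport is minus that of
-- F divided by f(ξ), with ξ between x and its image. The Lipschitz bound forces ξ → x.
open Filter Topology in
theorem hasDerivWithinAt_transport (j : Fin n) {γ' x : ℝ} (hγ' : γ' ∈ E.Γ)
    (hx : x ∈ Set.Icc (E.lo j) (E.hi j)) :
    HasDerivWithinAt (fun γ => E.transport j γ' γ x)
      (-(E.cdfDeriv j γ' x) / E.mdens j γ' x) E.Γ γ' := by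
  obtain ⟨L, -, hL⟩ := E.exists_transport_lipschitz
  choose ξ hξ h using fun γ => E.exists_cdf_sub_eq j γ x (E.transport j γ' γ x)
  have hlim : Tendsto ξ (𝓝[E.Γ] γ') (𝓝 x) := by
    refine tendsto_iff_norm_sub_tendsto_zero.2 ?_
    have h0 : Tendsto (fun γ => L * |γ - γ'|) (𝓝[E.Γ] γ') (𝓝 0) := by
      have : Continuous fun γ => L * |γ - γ'| := by fun_prop
      simpa using (this.tendsto γ').mono_left nhdsWithin_le_nhds
    refine squeeze_zero' (Eventually.of_forall fun _ => norm_nonneg _) ?_ h0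
    filter_upwards [self_mem_nhdsWithin] with γ hγ
    exact (Set.abs_sub_left_of_mem_uIcc (hξ γ)).trans (hL j γ' hγ' γ hγ x hx)
  have hm : Tendsto (fun γ => E.mdens j γ (ξ γ)) (𝓝[E.Γ] γ') (𝓝 (E.mdens j γ' x)) :=
    ((E.continuous_mdens j).tendsto (γ', x)).comp
      (Tendsto.prodMk_nhds (tendsto_nhdsWithin_of_tendsto_nhds tendsto_id) hlim)
  have hF := hasDerivWithinAt_iff_tendsto_slope.1 (E.hasDerivWithinAt_cdf j hγ' x)
  rw [hasDerivWithinAt_iff_tendsto_slope]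
  refine (hF.neg.div (hm.mono_left (nhdsWithin_mono _ Set.sdiff_subset))
    (E.mdens_pos j γ' x).ne').congr' ?_
  filter_upwards [self_mem_nhdsWithin] with γ hγ
  have h1 := h γ
  rw [E.cdf_transport j hγ' hγ.1, E.clampVal_of_mem hx] at h1
  have h2 := sub_ne_zero.2 hγ.2
  have h3 := (E.mdens_pos j γ (ξ γ)).ne'
  simp only [slope_def_field, Pi.div_apply]
  rw [E.transport_self j hγ' hx]
  field_simp
  linarith

end Environment

/-! ### Mimicking another type, and the envelope formula. -/

namespace Environment

variable {n : ℕ} (E : Environment n)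

/-- Conditional independence enters the argument through this identity: the joint law is the product
of its marginals. -/
theorem pathLaw_eq (hind : E.CondIndependent) {γ : ℝ} (hγ : γ ∈ E.Γ) :
    E.pathLaw γ = E.condLaw γ := by
  have h := (hind γ hγ).map_fun_eq_pi_map fun i => (measurable_pi_apply i).aemeasurable
  rw [pathLaw]
  exact h.symm.trans Measure.map_id

theorem isProbabilityMeasure_pathLaw {γ : ℝ} (hγ : γ ∈ E.Γ) :
    IsProbabilityMeasure (E.pathLaw γ) := by
  have := fun j => E.isProbabilityMeasure_marginalLaw j hγ
  rw [pathLaw]; infer_instance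

theorem ae_pathLaw_mem {γ : ℝ} (hγ : γ ∈ E.Γ) : ∀ᵐ θ ∂(E.pathLaw γ), θ ∈ E.Θ := by
  have := fun j => E.isProbabilityMeasure_marginalLaw j hγ
  simp_rw [E.mem_Θ_iff, ae_all_iff]
  intro j
  exact (Measure.quasiMeasurePreserving_eval (E.marginalLaw γ) j).ae (E.ae_marginalLaw_mem j hγ)

theorem integrable_pathLaw_of_bound {γ : ℝ} (hγ : γ ∈ E.Γ) {H : (Fin n → ℝ) → ℝ}
    (hH : Measurable H) (C : ℝ) (hC : ∀ θ ∈ E.Θ, |H θ| ≤ C) : Integrable H (E.pathLaw γ) := by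
  have := E.isProbabilityMeasure_pathLaw hγ
  refine Integrable.of_bound hH.aestronglyMeasurable C ?_
  filter_upwards [E.ae_pathLaw_mem hγ] with θ hθ using hC θ hθ

/-- The map that couples the law of the valuations given `γ'` with the one given `γ`. -/
def transportBox (γ' γ : ℝ) (θ : Fin n → ℝ) : Fin n → ℝ := fun j => E.transport j γ' γ (θ j)

theorem measurable_transportBox {γ' γ : ℝ} (hγ' : γ' ∈ E.Γ) (hγ : γ ∈ E.Γ) :
    Measurable (E.transportBox γ' γ) :=
  measurable_pi_lambda _ fun j =>
    (E.monotone_transport j hγ' hγ).measurable.comp (measurable_pi_apply j)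

theorem transportBox_mem {γ' γ : ℝ} (hγ' : γ' ∈ E.Γ) (hγ : γ ∈ E.Γ) (θ : Fin n → ℝ) :
    E.transportBox γ' γ θ ∈ E.Θ :=
  E.mem_Θ_iff.2 fun j => E.transport_mem j hγ' hγ _

theorem transportBox_transportBox {γ' γ : ℝ} (hγ' : γ' ∈ E.Γ) (hγ : γ ∈ E.Γ) {θ : Fin n → ℝ}
    (hθ : θ ∈ E.Θ) : E.transportBox γ γ' (E.transportBox γ' γ θ) = θ :=
  funext fun j => (E.transport_transport j hγ' hγ hγ' _).trans
    (E.transport_self j hγ' (E.mem_Θ_iff.1 hθ j))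

theorem isStrategy_transportBox {γ' γ : ℝ} (hγ' : γ' ∈ E.Γ) (hγ : γ ∈ E.Γ) :
    E.IsStrategy (E.transportBox γ' γ) :=
  ⟨E.measurable_transportBox hγ' hγ, fun θ _ => E.transportBox_mem hγ' hγ θ,
    fun i θ _ θ' _ h => by simp only [transportBox, h i le_rfl]⟩

theorem map_transportBox {γ' γ : ℝ} (hγ' : γ' ∈ E.Γ) (hγ : γ ∈ E.Γ) :
    (E.pathLaw γ').map (E.transportBox γ' γ) = E.pathLaw γ := by
  have := fun j => E.isProbabilityMeasure_marginalLaw j hγ'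
  have := fun j => E.isProbabilityMeasure_marginalLaw j hγ
  have h : ∀ j, SigmaFinite ((E.marginalLaw γ' j).map (E.transport j γ' γ)) := fun j => by
    rw [E.map_transport j hγ' hγ]; infer_instance
  refine (Measure.pi_map_pi fun j =>
    (E.monotone_transport j hγ' hγ).measurable.aemeasurable).trans ?_
  simp_rw [fun j => E.map_transport j hγ' hγ]
  rfl

variable {E} {m : SeqMechanism n}

theorem SeqFeasible.measurable_q (hm : E.SeqFeasible m) (γ : ℝ) (j : Fin n) :
    Measurable fun θ => m.q γ θ j :=
  (measurable_pi_apply j).comp (hm.1.comp measurable_prodMk_left)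

theorem SeqFeasible.abs_q_le (hm : E.SeqFeasible m) {γ : ℝ} (hγ : γ ∈ E.Γ) {θ : Fin n → ℝ}
    (hθ : θ ∈ E.Θ) (j : Fin n) : |m.q γ θ j| ≤ 1 := by
  rw [abs_of_nonneg (hm.2.2 γ hγ θ hθ j).1]; exact (hm.2.2 γ hγ θ hθ j).2

/-- Bound on an allocation-weighted sum. -/
theorem SeqFeasible.abs_sum_le (hm : E.SeqFeasible m) {γ : ℝ} (hγ : γ ∈ E.Γ) {θ : Fin n → ℝ}
    (hθ : θ ∈ E.Θ) {v : Fin n → ℝ} {C : ℝ} (hv : ∀ j, |v j| ≤ C) :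
    |∑ j, m.q γ θ j * v j| ≤ n * C := by
  refine (Finset.abs_sum_le_sum_abs _ _).trans ?_
  calc ∑ j, |m.q γ θ j * v j| ≤ ∑ _j : Fin n, C := Finset.sum_le_sum fun j _ => by
        rw [abs_mul]
        calc |m.q γ θ j| * |v j| ≤ 1 * |v j| :=
              mul_le_mul_of_nonneg_right (hm.abs_q_le hγ hθ j) (abs_nonneg _)
          _ ≤ C := by rw [one_mul]; exact hv j
    _ = n * C := by simp

variable (E) in
/-- The expected payoff of a truthful buyer. -/
def truthPayoff (m : SeqMechanism n) (γ : ℝ) : ℝ := ∫ θ, m.payoff γ θ θ ∂(E.pathLaw γ)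

variable (E) in
/-- What a buyer of type `γ` who behaves as if of type `γ'` gains over type `γ'`, as a function of
the reported valuations. -/
def mimicGain (m : SeqMechanism n) (γ' γ : ℝ) (θ : Fin n → ℝ) : ℝ :=
  ∑ j, m.q γ' θ j * (E.transport j γ' γ (θ j) - θ j)

variable (E) in
/-- The derivative of the truthful payoff in the type. -/
def rentRate (m : SeqMechanism n) (γ : ℝ) : ℝ :=
  ∫ θ, ∑ j, m.q γ θ j * (-(E.cdfDeriv j γ (θ j)) / E.mdens j γ (θ j)) ∂(E.pathLaw γ)

theorem SeqFeasible.measurable_mimicGain (hm : E.SeqFeasible m) {γ' γ : ℝ} (hγ' : γ' ∈ E.Γ)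
    (hγ : γ ∈ E.Γ) : Measurable (E.mimicGain m γ' γ) :=
  Finset.measurable_sum _ fun j _ => (hm.measurable_q γ' j).mul
    (((E.monotone_transport j hγ' hγ).measurable.comp (measurable_pi_apply j)).sub
      (measurable_pi_apply j))

/-- Transporting from γ to γ₂ factors through γ₁, so the Lipschitz bound holds between any two
target types and not only at the base type. Dominated differentiation needs this form. -/
theorem SeqFeasible.abs_mimicGain_sub_le (hm : E.SeqFeasible m) {L : ℝ}
    (hL : ∀ j, ∀ γ' ∈ E.Γ, ∀ γ ∈ E.Γ,
      ∀ x ∈ Set.Icc (E.lo j) (E.hi j), |E.transport j γ' γ x - x| ≤ L * |γ - γ'|)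
    {γ γ₁ γ₂ : ℝ} (hγ : γ ∈ E.Γ) (h₁ : γ₁ ∈ E.Γ) (h₂ : γ₂ ∈ E.Γ) {θ : Fin n → ℝ} (hθ : θ ∈ E.Θ) :
    |E.mimicGain m γ γ₂ θ - E.mimicGain m γ γ₁ θ| ≤ n * (L * |γ₂ - γ₁|) := by
  have : E.mimicGain m γ γ₂ θ - E.mimicGain m γ γ₁ θ =
      ∑ j, m.q γ θ j * (E.transport j γ γ₂ (θ j) - E.transport j γ γ₁ (θ j)) := by
    simp only [mimicGain, ← Finset.sum_sub_distrib]
    exact Finset.sum_congr rfl fun j _ => by ring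
  rw [this]
  refine hm.abs_sum_le hγ hθ fun j => ?_
  rw [← E.transport_transport j hγ h₁ h₂]
  exact hL j γ₁ h₁ γ₂ h₂ _ (E.transport_mem j hγ h₁ _)

theorem mimicGain_self {γ : ℝ} (hγ : γ ∈ E.Γ) {θ : Fin n → ℝ} (hθ : θ ∈ E.Θ) :
    E.mimicGain m γ γ θ = 0 :=
  Finset.sum_eq_zero fun j _ => by rw [E.transport_self j hγ (E.mem_Θ_iff.1 hθ j)]; ring

theorem SeqFeasible.integrable_mimicGain (hm : E.SeqFeasible m) {γ' γ : ℝ} (hγ' : γ' ∈ E.Γ)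
    (hγ : γ ∈ E.Γ) : Integrable (E.mimicGain m γ' γ) (E.pathLaw γ') := by
  obtain ⟨L, -, hL⟩ := E.exists_transport_lipschitz
  refine E.integrable_pathLaw_of_bound hγ' (hm.measurable_mimicGain hγ' hγ) (n * (L * |γ - γ'|))
    fun θ hθ => ?_
  simpa [mimicGain_self hγ' hθ] using hm.abs_mimicGain_sub_le hL hγ' hγ' hγ hθ

/-- A buyer of type `γ` may report `γ'` and transport the valuations. -/
theorem integral_mimicGain_le (hm : E.SeqFeasible m) (hIC : E.SeqICInitial m) {γ' γ : ℝ}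
    (hγ' : γ' ∈ E.Γ) (hγ : γ ∈ E.Γ) :
    ∫ θ, E.mimicGain m γ' γ θ ∂(E.pathLaw γ') ≤ E.truthPayoff m γ - E.truthPayoff m γ' := by
  have hT := E.measurable_transportBox hγ' hγ
  have hmeas : Measurable fun θ => m.payoff γ' (E.transportBox γ γ' θ) θ := by
    have hσ := E.measurable_transportBox hγ hγ'
    refine (Finset.measurable_sum _ fun j _ => ?_).sub ?_
    · exact ((hm.measurable_q γ' j).comp hσ).mul (measurable_pi_apply j)
    · exact (hm.2.1.comp measurable_prodMk_left).comp hσ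
  -- Transporting there and back restores the report θ, so allocation and transfer are those of type
  -- γ'. Only the valuations of the goods differ, by the transport displacement.
  have heq : (fun θ => m.payoff γ' (E.transportBox γ γ' (E.transportBox γ' γ θ))
      (E.transportBox γ' γ θ)) =ᵐ[E.pathLaw γ']
        fun θ => m.payoff γ' θ θ + E.mimicGain m γ' γ θ := by
    filter_upwards [E.ae_pathLaw_mem hγ'] with θ hθ
    rw [E.transportBox_transportBox hγ' hγ hθ]
    simp only [SeqMechanism.payoff, mimicGain, transportBox, mul_sub, Finset.sum_sub_distrib]
    ring
  have hi : Integrable (fun θ => m.payoff γ' θ θ + E.mimicGain m γ' γ θ) (E.pathLaw γ') :=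
    (hIC γ' hγ').1.add (hm.integrable_mimicGain hγ' hγ)
  have hint : Integrable (fun θ => m.payoff γ' (E.transportBox γ γ' θ) θ) (E.pathLaw γ) := by
    rw [← E.map_transportBox hγ' hγ, integrable_map_measure hmeas.aestronglyMeasurable
      hT.aemeasurable]
    exact hi.congr heq.symm
  have h := (hIC γ hγ).2 γ' hγ' _ (E.isStrategy_transportBox hγ hγ') hint
  rw [← E.map_transportBox hγ' hγ, integral_map hT.aemeasurable hmeas.aestronglyMeasurable,
    integral_congr_ae heq, integral_add (hIC γ' hγ').1 (hm.integrable_mimicGain hγ' hγ),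
    E.map_transportBox hγ' hγ] at h
  unfold truthPayoff
  linarith

/-- Mimicking in either direction costs at most a multiple of the distance of the types, because
allocations lie in [0, 1] and the transport is Lipschitz. -/
theorem exists_lipschitzOnWith_truthPayoff (hm : E.SeqFeasible m) (hIC : E.SeqICInitial m) :
    ∃ K, LipschitzOnWith K (E.truthPayoff m) E.Γ := by
  obtain ⟨L, hL0, hL⟩ := E.exists_transport_lipschitz
  refine ⟨Real.toNNReal (n * L), LipschitzOnWith.of_le_add_mul _ fun γ hγ γ' hγ' => ?_⟩
  have h1 := integral_mimicGain_le hm hIC hγ hγ'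
  have h2 : |∫ θ, E.mimicGain m γ γ' θ ∂(E.pathLaw γ)| ≤ n * (L * |γ' - γ|) := by
    have := E.isProbabilityMeasure_pathLaw hγ
    have h := norm_integral_le_of_norm_le_const (μ := E.pathLaw γ) (f := E.mimicGain m γ γ')
      (C := n * (L * |γ' - γ|)) (by
        filter_upwards [E.ae_pathLaw_mem hγ] with θ hθ
        simpa [mimicGain_self hγ hθ] using hm.abs_mimicGain_sub_le hL hγ hγ hγ' hθ)
    simpa using h
  rw [Real.coe_toNNReal _ (by positivity), Real.dist_eq, abs_sub_comm]
  have := (abs_le.1 h2).1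
  linarith

theorem SeqFeasible.hasDerivAt_integral_mimicGain (hm : E.SeqFeasible m) {γ : ℝ}
    (hγ : γ ∈ Set.Ioo E.γlo E.γhi) :
    HasDerivAt (fun s => ∫ θ, E.mimicGain m γ s θ ∂(E.pathLaw γ)) (E.rentRate m γ) γ := by
  have hγ' : γ ∈ E.Γ := Set.Ioo_subset_Icc_self hγ
  have hnhds : E.Γ ∈ nhds γ := Icc_mem_nhds hγ.1 hγ.2
  have := E.isProbabilityMeasure_pathLaw hγ'
  obtain ⟨L, hL0, hL⟩ := E.exists_transport_lipschitz
  refine (hasDerivAt_integral_of_dominated_loc_of_lip (bound := fun _ => n * L)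
    hnhds ?_ (hm.integrable_mimicGain hγ' hγ') ?_ ?_ (integrable_const _) ?_).2
  · filter_upwards [hnhds] with s hs
    exact (hm.measurable_mimicGain hγ' hs).aestronglyMeasurable
  · refine (Finset.measurable_sum _ fun j _ => (hm.measurable_q γ j).mul ?_).aestronglyMeasurable
    exact ((E.continuous_cdfDeriv_right j γ).measurable.comp (measurable_pi_apply j)).neg.div
      ((E.continuous_mdens_right j γ).measurable.comp (measurable_pi_apply j))
  · filter_upwards [E.ae_pathLaw_mem hγ'] with θ hθ
    refine LipschitzOnWith.of_dist_le_mul fun s hs s' hs' => ?_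
    have h := hm.abs_mimicGain_sub_le hL hγ' hs' hs hθ
    rw [Real.dist_eq, Real.dist_eq, Real.coe_nnabs, abs_of_nonneg (by positivity : 0 ≤ n * L)]
    linarith
  · filter_upwards [E.ae_pathLaw_mem hγ'] with θ hθ
    refine HasDerivAt.fun_sum fun j _ => HasDerivAt.const_mul _ (HasDerivAt.sub_const _ ?_)
    exact (E.hasDerivWithinAt_transport j hγ' (E.mem_Θ_iff.1 hθ j)).hasDerivAt hnhds

theorem deriv_truthPayoff (hm : E.SeqFeasible m) (hIC : E.SeqICInitial m) {γ : ℝ}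
    (hγ : γ ∈ Set.Ioo E.γlo E.γhi) (hd : DifferentiableAt ℝ (E.truthPayoff m) γ) :
    deriv (E.truthPayoff m) γ = E.rentRate m γ := by
  have hγ' : γ ∈ E.Γ := Set.Ioo_subset_Icc_self hγ
  have h0 : ∫ θ, E.mimicGain m γ γ θ ∂(E.pathLaw γ) = 0 := by
    refine integral_eq_zero_of_ae ?_
    filter_upwards [E.ae_pathLaw_mem hγ'] with θ hθ using mimicGain_self hγ' hθ
  -- The mimicking inequality says that U(s) minus the gain from mimicking γ is minimal at s = γ,
  -- where the gain is zero. Hence the two derivatives agree there.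
  have hmin : IsLocalMin (fun s => E.truthPayoff m s -
      ∫ θ, E.mimicGain m γ s θ ∂(E.pathLaw γ)) γ := by
    filter_upwards [Icc_mem_nhds hγ.1 hγ.2] with s hs
    have := integral_mimicGain_le hm hIC hγ' hs
    rw [h0]
    linarith
  have h := hmin.hasDerivAt_eq_zero (hd.hasDerivAt.sub (hm.hasDerivAt_integral_mimicGain hγ))
  linarith

end Environment

/-! ### Revenue as virtual surplus, and the upper bound. -/

namespace Environment

variable {n : ℕ} (E : Environment n)

/-- Otherwise the Bochner integral would take its default value 0, not 1. -/
theorem integrableOn_g : IntegrableOn E.g E.Γ := by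
  by_contra h
  have h1 := E.integral_g
  have h2 : ∫ γ in Set.Icc E.γlo E.γhi, E.g γ = 0 := integral_undef h
  linarith

theorem integral_typeLaw (H : ℝ → ℝ) :
    ∫ γ, H γ ∂E.typeLaw = ∫ γ in E.Γ, E.g γ * H γ := by
  rw [typeLaw, integral_withDensity_eq_integral_toReal_smul E.measurable_g.ennreal_ofReal
    (Filter.Eventually.of_forall fun _ => ENNReal.ofReal_lt_top)]
  refine setIntegral_congr_fun E.measurableSet_Γ fun γ hγ => ?_
  simp only [smul_eq_mul]
  rw [ENNReal.toReal_ofReal (E.g_pos γ hγ).le]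

theorem integral_condLaw {γ : ℝ} (hγ : γ ∈ E.Γ) (H : (Fin n → ℝ) → ℝ) :
    ∫ θ, H θ ∂(E.condLaw γ) = ∫ θ in E.Θ, E.dens γ θ * H θ := by
  rw [E.condLaw_eq hγ, integral_withDensity_eq_integral_toReal_smul (E.measurable_ofReal_dens γ)
    (Filter.Eventually.of_forall fun _ => ENNReal.ofReal_lt_top)]
  refine setIntegral_congr_fun E.measurableSet_Θ fun θ _ => ?_
  simp only [smul_eq_mul]
  rw [ENNReal.toReal_ofReal (E.dens_pos γ θ).le]

theorem typeLaw_apply {s : Set ℝ} (hs : MeasurableSet s) :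
    E.typeLaw s = ENNReal.ofReal (∫ γ in s ∩ E.Γ, E.g γ) := by
  rw [typeLaw, withDensity_apply _ hs, Measure.restrict_restrict hs,
    ofReal_integral_eq_lintegral_ofReal (E.integrableOn_g.mono_set Set.inter_subset_right)]
  filter_upwards [ae_restrict_mem (hs.inter E.measurableSet_Γ)] with γ hγ using (E.g_pos γ hγ.2).le

theorem isProbabilityMeasure_typeLaw : IsProbabilityMeasure E.typeLaw := by
  constructor
  rw [E.typeLaw_apply MeasurableSet.univ, Set.univ_inter, Γ, E.integral_g, ENNReal.ofReal_one]

theorem G_nonneg (γ : ℝ) : 0 ≤ E.G γ := measureReal_nonneg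

theorem G_le_one (γ : ℝ) : E.G γ ≤ 1 := by
  have := E.isProbabilityMeasure_typeLaw
  exact measureReal_le_one

theorem measurable_G : Measurable E.G := by
  have := E.isProbabilityMeasure_typeLaw
  exact Monotone.measurable fun x y hxy => measureReal_mono (Set.Iic_subset_Iic.2 hxy)

theorem G_eq {γ : ℝ} (hγ : γ ∈ E.Γ) : E.G γ = ∫ s in E.γlo..γ, E.g s := by
  have h : Set.Iic γ ∩ E.Γ = Set.Icc E.γlo γ := by
    ext y; simp only [Γ, Set.mem_inter_iff, Set.mem_Iic, Set.mem_Icc]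
    exact ⟨fun h => ⟨h.2.1, h.1⟩, fun h => ⟨h.2, h.1, h.2.trans hγ.2⟩⟩
  rw [G, Measure.real, E.typeLaw_apply measurableSet_Iic, h, ENNReal.toReal_ofReal,
    intervalIntegral.integral_of_le hγ.1, integral_Icc_eq_integral_Ioc]
  exact setIntegral_nonneg measurableSet_Icc fun s hs =>
    (E.g_pos s ⟨hs.1, hs.2.trans hγ.2⟩).le

theorem intervalIntegrable_g : IntervalIntegrable E.g volume E.γlo E.γhi := by
  rw [intervalIntegrable_iff_integrableOn_Icc_of_le E.γlo_lt_γhi.le]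
  exact E.integrableOn_g

theorem setIntegral_Γ_eq (H : ℝ → ℝ) : ∫ γ in E.Γ, H γ = ∫ γ in E.γlo..E.γhi, H γ := by
  rw [intervalIntegral.integral_of_le E.γlo_lt_γhi.le, Γ, integral_Icc_eq_integral_Ioc]

/-- The expectation of a Lipschitz function of the type, by parts. -/
theorem integral_g_mul_of_lipschitz {U : ℝ → ℝ} {K : NNReal} (hU : LipschitzOnWith K U E.Γ) :
    ∫ γ in E.Γ, E.g γ * U γ = U E.γlo + ∫ γ in E.Γ, (1 - E.G γ) * deriv U γ := by
  have hle := E.γlo_lt_γhi.le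
  have hΓ : Set.uIcc E.γlo E.γhi = E.Γ := Set.uIcc_of_le hle
  have hUac : AbsolutelyContinuousOnInterval U E.γlo E.γhi :=
    LipschitzOnWith.absolutelyContinuousOnInterval (K := K) (by rwa [hΓ])
  have hGac := E.intervalIntegrable_g.absolutelyContinuousOnInterval_intervalIntegral
    (c := E.γlo) Set.left_mem_uIcc
  have h1 := hUac.integral_mul_deriv_eq_deriv_mul hGac
  have h2 := hUac.integral_deriv_eq_sub
  have h3 : ∫ s in E.γlo..E.γhi, E.g s = 1 := by rw [← E.setIntegral_Γ_eq]; exact E.integral_g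
  rw [intervalIntegral.integral_same, h3] at h1
  -- Since `g` is merely integrable, its primitive has derivative `g` only almost everywhere;
  -- absolute continuity is what justifies the integration by parts.
  have h4 : ∫ γ in E.γlo..E.γhi, U γ * deriv (fun x => ∫ s in E.γlo..x, E.g s) γ =
      ∫ γ in E.γlo..E.γhi, E.g γ * U γ := by
    refine intervalIntegral.integral_congr_ae ?_
    filter_upwards [E.intervalIntegrable_g.ae_hasDerivAt_integral] with γ hγ hmem
    rw [(hγ (Set.uIoc_subset_uIcc hmem) E.γlo Set.left_mem_uIcc).deriv, mul_comm]
  have h5 : ∫ γ in E.γlo..E.γhi, (1 - E.G γ) * deriv U γ =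
      (∫ γ in E.γlo..E.γhi, deriv U γ) -
        ∫ γ in E.γlo..E.γhi, deriv U γ * ∫ s in E.γlo..γ, E.g s := by
    rw [← intervalIntegral.integral_sub hUac.intervalIntegrable_deriv
      (hUac.intervalIntegrable_deriv.mul_continuousOn hGac.continuousOn)]
    refine intervalIntegral.integral_congr fun γ hγ => ?_
    rw [E.G_eq (hΓ ▸ hγ)]
    ring
  rw [E.setIntegral_Γ_eq, E.setIntegral_Γ_eq, ← h4, h1, h5, h2]
  ring

theorem exists_bound : ∃ A : ℝ, 0 ≤ A ∧ ∀ γ ∈ E.Γ, ∀ θ ∈ E.Θ, |E.dens γ θ| ≤ A ∧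
    ∀ j, |θ j| ≤ A ∧ |E.cdfDeriv j γ (θ j) / E.mdens j γ (θ j)| ≤ A := by
  have hc : IsCompact (E.Γ ×ˢ E.Θ) := isCompact_Icc.prod isCompact_Icc
  obtain ⟨A₁, h₁⟩ := hc.exists_bound_of_continuousOn E.continuous_dens.continuousOn
  have hθ : ∀ j, Continuous fun p : ℝ × (Fin n → ℝ) => ((p.1, p.2 j) : ℝ × ℝ) := fun j => by
    fun_prop
  choose A₂ h₂ using fun j => hc.exists_bound_of_continuousOn
    (f := fun p : ℝ × (Fin n → ℝ) => p.2 j) (by fun_prop)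
  choose A₃ h₃ using fun j => hc.exists_bound_of_continuousOn
    (((E.continuous_cdfDeriv j).comp (hθ j)).div ((E.continuous_mdens j).comp (hθ j))
      fun p => (E.mdens_pos j _ _).ne').continuousOn
  have hs2 : ∀ j, |A₂ j| ≤ ∑ j, |A₂ j| := fun j =>
    Finset.single_le_sum (f := fun j => |A₂ j|) (fun _ _ => abs_nonneg _) (Finset.mem_univ j)
  have hs3 : ∀ j, |A₃ j| ≤ ∑ j, |A₃ j| := fun j =>
    Finset.single_le_sum (f := fun j => |A₃ j|) (fun _ _ => abs_nonneg _) (Finset.mem_univ j)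
  have hn2 : 0 ≤ ∑ j, |A₂ j| := Finset.sum_nonneg fun _ _ => abs_nonneg _
  have hn3 : 0 ≤ ∑ j, |A₃ j| := Finset.sum_nonneg fun _ _ => abs_nonneg _
  have hn1 := abs_nonneg A₁
  refine ⟨|A₁| + ∑ j, |A₂ j| + ∑ j, |A₃ j|, by positivity, fun γ hγ θ hθ => ⟨?_, fun j => ⟨?_, ?_⟩⟩⟩
  · have := h₁ (γ, θ) ⟨hγ, hθ⟩
    rw [Real.norm_eq_abs] at this
    linarith [le_abs_self A₁]
  · have := h₂ j (γ, θ) ⟨hγ, hθ⟩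
    rw [Real.norm_eq_abs] at this
    linarith [le_abs_self (A₂ j), hs2 j]
  · have := h₃ j (γ, θ) ⟨hγ, hθ⟩
    rw [Real.norm_eq_abs] at this
    simp only [Pi.div_apply, Function.comp_apply] at this
    linarith [le_abs_self (A₃ j), hs3 j]

/-- The density `g` need not be bounded, so integrands are dominated by a multiple of g + 1, which
is integrable on Γ. -/
theorem integrableOn_prod_of_bound {H : ℝ × (Fin n → ℝ) → ℝ} (hH : Measurable H) (C : ℝ)
    (hC : ∀ γ ∈ E.Γ, ∀ θ ∈ E.Θ, |H (γ, θ)| ≤ C * (E.g γ + 1)) :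
    IntegrableOn H (E.Γ ×ˢ E.Θ) := by
  have h1 : Integrable (fun p : ℝ × (Fin n → ℝ) => C * (E.g p.1 + 1) * 1)
      ((volume.restrict E.Γ).prod (volume.restrict E.Θ)) := by
    have : IsFiniteMeasure (volume.restrict E.Γ) := ⟨by
      rw [Measure.restrict_apply_univ]; exact isCompact_Icc.measure_lt_top⟩
    have : IsFiniteMeasure (volume.restrict E.Θ) := ⟨by
      rw [Measure.restrict_apply_univ]; exact isCompact_Icc.measure_lt_top⟩
    have hg : Integrable (fun γ => C * (E.g γ + 1)) (volume.restrict E.Γ) :=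
      (Integrable.add E.integrableOn_g (integrable_const _)).const_mul C
    exact hg.mul_prod (integrable_const (1 : ℝ))
  rw [Measure.prod_restrict] at h1
  refine Integrable.mono' h1 hH.aestronglyMeasurable ?_
  filter_upwards [ae_restrict_mem (E.measurableSet_Γ.prod E.measurableSet_Θ)] with p hp
  rw [mul_one]
  exact hC p.1 hp.1 p.2 hp.2

theorem setIntegral_Γ_prod_Θ {H : ℝ × (Fin n → ℝ) → ℝ} (hH : IntegrableOn H (E.Γ ×ˢ E.Θ)) :
    ∫ p in E.Γ ×ˢ E.Θ, H p = ∫ γ in E.Γ, ∫ θ in E.Θ, H (γ, θ) :=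
  setIntegral_prod H hH

theorem integrableOn_setIntegral {H : ℝ × (Fin n → ℝ) → ℝ} (hH : IntegrableOn H (E.Γ ×ˢ E.Θ)) :
    IntegrableOn (fun γ => ∫ θ in E.Θ, H (γ, θ)) E.Γ := by
  rw [IntegrableOn, Measure.volume_eq_prod, ← Measure.prod_restrict] at hH
  exact hH.integral_prod_left

/-- The virtual value, times the density of the type. -/
def weightedValue (j : Fin n) (γ x : ℝ) : ℝ :=
  E.g γ * x + (1 - E.G γ) * (E.cdfDeriv j γ x / E.mdens j γ x)

theorem weightedValue_eq (j : Fin n) {γ x : ℝ} (hγ : γ ∈ E.Γ)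
    (hx : x ∈ Set.Icc (E.lo j) (E.hi j)) :
    E.weightedValue j γ x = E.g γ * E.virtualValue j γ x := by
  have hg := (E.g_pos γ hγ).ne'
  rw [weightedValue, virtualValue, E.marginalCDFDeriv_eq j hγ hx,
    E.mdens_eq_marginalDensity j hγ hx]
  have hm := (E.mdens_pos j γ x).ne'
  field_simp

theorem measurable_weightedValue (j : Fin n) :
    Measurable fun p : ℝ × (Fin n → ℝ) => E.weightedValue j p.1 (p.2 j) := by
  have h : Measurable fun p : ℝ × (Fin n → ℝ) => ((p.1, p.2 j) : ℝ × ℝ) := by fun_prop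
  exact ((E.measurable_g.comp measurable_fst).mul (by fun_prop)).add
    ((measurable_const.sub (E.measurable_G.comp measurable_fst)).mul
      (((E.continuous_cdfDeriv j).measurable.comp h).div
        ((E.continuous_mdens j).measurable.comp h)))

theorem abs_weightedValue_le {A : ℝ} {γ x : ℝ} (hγ : γ ∈ E.Γ) (j : Fin n) (hx : |x| ≤ A)
    (hD : |E.cdfDeriv j γ x / E.mdens j γ x| ≤ A) :
    |E.weightedValue j γ x| ≤ A * (E.g γ + 1) := by
  have h1 := E.G_nonneg γ
  have h2 := E.G_le_one γ
  calc |E.weightedValue j γ x| ≤ |E.g γ * x| + |(1 - E.G γ) * _| := abs_add_le _ _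
    _ ≤ E.g γ * A + 1 * A := by
      rw [abs_mul, abs_mul, abs_of_pos (E.g_pos γ hγ), abs_of_nonneg (sub_nonneg.2 h2)]
      gcongr
      · exact (E.g_pos γ hγ).le
      · linarith
    _ = A * (E.g γ + 1) := by ring

/-- The density with which an allocation rule contributes to the expected virtual surplus. -/
def surplus (q : ℝ → (Fin n → ℝ) → (Fin n → ℝ)) (p : ℝ × (Fin n → ℝ)) : ℝ :=
  E.dens p.1 p.2 * ∑ j, q p.1 p.2 j * E.weightedValue j p.1 (p.2 j)

/-- The pointwise maximum of `surplus`. -/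
def maxSurplus (p : ℝ × (Fin n → ℝ)) : ℝ :=
  E.dens p.1 p.2 * ∑ j, max (E.weightedValue j p.1 (p.2 j)) 0

theorem integrableOn_dens_mul_sum {v : Fin n → ℝ × (Fin n → ℝ) → ℝ} (hv : ∀ j, Measurable (v j))
    (C : ℝ) (hC : ∀ γ ∈ E.Γ, ∀ θ ∈ E.Θ, ∀ j, |v j (γ, θ)| ≤ C * (E.g γ + 1)) :
    IntegrableOn (fun p : ℝ × (Fin n → ℝ) => E.dens p.1 p.2 * ∑ j, v j p) (E.Γ ×ˢ E.Θ) := by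
  obtain ⟨A, hA0, hA⟩ := E.exists_bound
  refine E.integrableOn_prod_of_bound
    (E.continuous_dens.measurable.mul (Finset.measurable_sum _ fun j _ => hv j))
    (A * (n * C)) fun γ hγ θ hθ => ?_
  have h1 : |∑ j, v j (γ, θ)| ≤ n * (C * (E.g γ + 1)) := by
    refine (Finset.abs_sum_le_sum_abs _ _).trans ?_
    refine (Finset.sum_le_sum fun j _ => hC γ hγ θ hθ j).trans ?_
    simp
  rw [abs_mul]
  calc _ ≤ A * (n * (C * (E.g γ + 1))) :=
        mul_le_mul (hA γ hγ θ hθ).1 h1 (abs_nonneg _) hA0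
    _ = _ := by ring

theorem integrableOn_maxSurplus : IntegrableOn E.maxSurplus (E.Γ ×ˢ E.Θ) := by
  obtain ⟨A, hA0, hA⟩ := E.exists_bound
  refine E.integrableOn_dens_mul_sum (fun j => (E.measurable_weightedValue j).max measurable_const)
    A fun γ hγ θ hθ j => ?_
  refine le_trans ?_ (E.abs_weightedValue_le hγ j ((hA γ hγ θ hθ).2 j).1 ((hA γ hγ θ hθ).2 j).2)
  rw [abs_of_nonneg (le_max_right _ _)]
  exact max_le (le_abs_self _) (abs_nonneg _)

theorem pointwiseMax_eq : E.pointwiseMax = ∫ p in E.Γ ×ˢ E.Θ, E.maxSurplus p := by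
  rw [pointwiseMax, E.integral_typeLaw, E.setIntegral_Γ_prod_Θ E.integrableOn_maxSurplus]
  refine setIntegral_congr_fun E.measurableSet_Γ fun γ hγ => ?_
  rw [E.integral_condLaw hγ, ← integral_const_mul]
  refine setIntegral_congr_fun E.measurableSet_Θ fun θ hθ => ?_
  simp only [maxSurplus, mul_left_comm (E.g γ), Finset.mul_sum]
  refine Finset.sum_congr rfl fun j _ => ?_
  rw [E.weightedValue_eq j hγ (E.mem_Θ_iff.1 hθ j), mul_max_of_nonneg _ _ (E.g_pos γ hγ).le,
    mul_zero]

variable {E} {m : SeqMechanism n}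

theorem SeqFeasible.measurable_q_prod (hm : E.SeqFeasible m) (j : Fin n) :
    Measurable fun p : ℝ × (Fin n → ℝ) => m.q p.1 p.2 j :=
  (measurable_pi_apply j).comp hm.1

theorem SeqFeasible.integrableOn_dens_mul (hm : E.SeqFeasible m)
    {v : Fin n → ℝ × (Fin n → ℝ) → ℝ} (hv : ∀ j, Measurable (v j)) (C : ℝ)
    (hC : ∀ γ ∈ E.Γ, ∀ θ ∈ E.Θ, ∀ j, |v j (γ, θ)| ≤ C * (E.g γ + 1)) :
    IntegrableOn (fun p : ℝ × (Fin n → ℝ) => E.dens p.1 p.2 * ∑ j, m.q p.1 p.2 j * v j p)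
      (E.Γ ×ˢ E.Θ) := by
  refine E.integrableOn_dens_mul_sum (fun j => (hm.measurable_q_prod j).mul (hv j)) C
    fun γ hγ θ hθ j => ?_
  rw [abs_mul]
  exact (mul_le_of_le_one_left (abs_nonneg _) (hm.abs_q_le hγ hθ j)).trans (hC γ hγ θ hθ j)

theorem SeqFeasible.integrableOn_surplus (hm : E.SeqFeasible m) :
    IntegrableOn (E.surplus m.q) (E.Γ ×ˢ E.Θ) := by
  obtain ⟨A, hA0, hA⟩ := E.exists_bound
  exact hm.integrableOn_dens_mul (fun j => E.measurable_weightedValue j) A fun γ hγ θ hθ j =>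
    E.abs_weightedValue_le hγ j ((hA γ hγ θ hθ).2 j).1 ((hA γ hγ θ hθ).2 j).2

theorem ae_deriv_truthPayoff (hm : E.SeqFeasible m) (hIC : E.SeqICInitial m) :
    ∀ᵐ γ, γ ∈ E.Γ → deriv (E.truthPayoff m) γ = E.rentRate m γ := by
  obtain ⟨K, hK⟩ := exists_lipschitzOnWith_truthPayoff hm hIC
  have hΓ : Set.uIcc E.γlo E.γhi = E.Γ := Set.uIcc_of_le E.γlo_lt_γhi.le
  have hUac : AbsolutelyContinuousOnInterval (E.truthPayoff m) E.γlo E.γhi :=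
    LipschitzOnWith.absolutelyContinuousOnInterval (K := K) (by rwa [hΓ])
  have h1 := Measure.ae_ne (volume : Measure ℝ) E.γlo
  have h2 := Measure.ae_ne (volume : Measure ℝ) E.γhi
  filter_upwards [hUac.ae_differentiableAt, h1, h2] with γ hγ hne hne' hmem
  exact deriv_truthPayoff hm hIC ⟨lt_of_le_of_ne hmem.1 (Ne.symm hne), lt_of_le_of_ne hmem.2 hne'⟩
    (hγ (hΓ ▸ hmem))

/-- Revenue is the virtual surplus net of the payoff of the lowest type. -/
theorem seqProfit_eq (hind : E.CondIndependent) (hm : E.SeqFeasible m)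
    (hIC : E.SeqICInitial m) :
    E.seqProfit m = (∫ p in E.Γ ×ˢ E.Θ, E.surplus m.q p) - E.truthPayoff m E.γlo := by
  obtain ⟨A, hA0, hA⟩ := E.exists_bound
  obtain ⟨K, hK⟩ := exists_lipschitzOnWith_truthPayoff hm hIC
  have hval := hm.integrableOn_dens_mul (v := fun j p => E.g p.1 * p.2 j)
    (fun j => (E.measurable_g.comp measurable_fst).mul (by fun_prop)) A fun γ hγ θ hθ j => by
      have := ((hA γ hγ θ hθ).2 j).1
      have hg := E.g_pos γ hγ
      rw [abs_mul, abs_of_pos hg]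
      nlinarith [mul_le_mul_of_nonneg_left this hg.le]
  have hinner : ∀ γ ∈ E.Γ, E.g γ * ∫ θ, m.t γ θ ∂(E.pathLaw γ) =
      (∫ θ in E.Θ, E.dens γ θ * ∑ j, m.q γ θ j * (E.g γ * θ j)) - E.g γ * E.truthPayoff m γ := by
    intro γ hγ
    have hi : Integrable (fun θ => ∑ j, m.q γ θ j * θ j) (E.pathLaw γ) :=
      E.integrable_pathLaw_of_bound hγ (Finset.measurable_sum _ fun j _ =>
        (hm.measurable_q γ j).mul (measurable_pi_apply j)) (n * A) fun θ hθ =>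
          hm.abs_sum_le hγ hθ fun j => ((hA γ hγ θ hθ).2 j).1
    have ht : ∫ θ, m.t γ θ ∂(E.pathLaw γ) =
        (∫ θ, ∑ j, m.q γ θ j * θ j ∂(E.pathLaw γ)) - E.truthPayoff m γ := by
      rw [truthPayoff, ← integral_sub hi (hIC γ hγ).1]
      congr 1
      ext θ
      simp [SeqMechanism.payoff]
    rw [ht, mul_sub, E.pathLaw_eq hind hγ, E.integral_condLaw hγ, ← integral_const_mul]
    congr 2
    ext θ
    rw [mul_left_comm, Finset.mul_sum]
    congr 2
    ext j
    ring
  -- By the envelope formula the weighted slope of the rent is gross surplus minus virtual surplus: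
  -- the term in (1 - G) F_γ/f is precisely what separates `weightedValue` from g times the
  -- valuation.
  have hrent : ∀ᵐ γ, γ ∈ E.Γ → (1 - E.G γ) * deriv (E.truthPayoff m) γ =
      (∫ θ in E.Θ, E.dens γ θ * ∑ j, m.q γ θ j * (E.g γ * θ j)) -
        ∫ θ in E.Θ, E.surplus m.q (γ, θ) := by
    filter_upwards [ae_deriv_truthPayoff hm hIC] with γ hd hγ
    rw [hd hγ, rentRate, E.pathLaw_eq hind hγ, E.integral_condLaw hγ, ← integral_const_mul]
    have hb : ∀ v : Fin n → (Fin n → ℝ) → ℝ, (∀ j, Measurable (v j)) → ∀ C : ℝ,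
        (∀ θ ∈ E.Θ, ∀ j, |v j θ| ≤ C) →
        IntegrableOn (fun θ => E.dens γ θ * ∑ j, m.q γ θ j * v j θ) E.Θ := by
      intro v hv C hC
      refine Measure.integrableOn_of_bounded (M := A * (n * C)) isCompact_Icc.measure_lt_top.ne
        ((E.continuous_dens_right γ).measurable.mul (Finset.measurable_sum _ fun j _ =>
          (hm.measurable_q γ j).mul (hv j))).aestronglyMeasurable ?_
      filter_upwards [ae_restrict_mem E.measurableSet_Θ] with θ hθ
      rw [Real.norm_eq_abs, abs_mul]
      exact mul_le_mul (hA γ hγ θ hθ).1 (hm.abs_sum_le hγ hθ (hC θ hθ)) (abs_nonneg _) hA0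
    have hi1 := hb (fun j θ => E.g γ * θ j) (fun j => by fun_prop) (E.g γ * A) fun θ hθ j => by
      rw [abs_mul, abs_of_pos (E.g_pos γ hγ)]
      exact mul_le_mul_of_nonneg_left ((hA γ hγ θ hθ).2 j).1 (E.g_pos γ hγ).le
    have hi2 := hb (fun j θ => E.weightedValue j γ (θ j))
      (fun j => (E.measurable_weightedValue j).comp measurable_prodMk_left) (A * (E.g γ + 1))
      fun θ hθ j => E.abs_weightedValue_le hγ j ((hA γ hγ θ hθ).2 j).1 ((hA γ hγ θ hθ).2 j).2
    unfold surplus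
    rw [← integral_sub hi1 hi2]
    congr 1
    ext θ
    simp only [weightedValue]
    rw [← mul_sub, ← Finset.sum_sub_distrib, mul_left_comm, Finset.mul_sum]
    congr 2
    ext j
    ring
  have hcont := hK.continuousOn
  have hU : IntegrableOn (fun γ => E.g γ * E.truthPayoff m γ) E.Γ :=
    E.integrableOn_g.mul_continuousOn hcont isCompact_Icc
  have hrent' : ∫ γ in E.Γ, (1 - E.G γ) * deriv (E.truthPayoff m) γ =
      (∫ γ in E.Γ, ∫ θ in E.Θ, E.dens γ θ * ∑ j, m.q γ θ j * (E.g γ * θ j)) -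
        ∫ p in E.Γ ×ˢ E.Θ, E.surplus m.q p := by
    rw [E.setIntegral_Γ_prod_Θ hm.integrableOn_surplus,
      ← integral_sub (E.integrableOn_setIntegral hval)
        (E.integrableOn_setIntegral hm.integrableOn_surplus)]
    exact setIntegral_congr_ae E.measurableSet_Γ hrent
  rw [seqProfit, E.integral_typeLaw, setIntegral_congr_fun E.measurableSet_Γ hinner,
    integral_sub (E.integrableOn_setIntegral hval) hU, E.integral_g_mul_of_lipschitz hK, hrent']
  ring

theorem SeqFeasible.surplus_le (hm : E.SeqFeasible m) {p : ℝ × (Fin n → ℝ)}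
    (hp : p ∈ E.Γ ×ˢ E.Θ) : E.surplus m.q p ≤ E.maxSurplus p := by
  refine mul_le_mul_of_nonneg_left (Finset.sum_le_sum fun j _ => ?_) (E.dens_pos _ _).le
  have h := hm.2.2 p.1 hp.1 p.2 hp.2 j
  rcases le_total 0 (E.weightedValue j p.1 (p.2 j)) with h0 | h0
  · exact (mul_le_of_le_one_left h0 h.2).trans (le_max_left _ _)
  · exact (mul_nonpos_of_nonneg_of_nonpos h.1 h0).trans (le_max_right _ _)

theorem seqProfit_le_pointwiseMax (hind : E.CondIndependent) (hm : E.SeqImplementable m) :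
    E.seqProfit m ≤ E.pointwiseMax := by
  rw [seqProfit_eq hind hm.1 hm.2.1, E.pointwiseMax_eq]
  have h1 := setIntegral_mono_on hm.1.integrableOn_surplus E.integrableOn_maxSurplus
    (E.measurableSet_Γ.prod E.measurableSet_Θ) fun p hp => hm.1.surplus_le hp
  have h2 : 0 ≤ E.truthPayoff m E.γlo := hm.2.2.2 _ E.γlo_mem
  linarith

/-- A mechanism that attains the upper bound has the pointwise optimal allocation. -/
theorem ae_eq_pointwiseRule (hind : E.CondIndependent) (hm : E.SeqImplementable m)
    (hopt : E.pointwiseMax ≤ E.seqProfit m) :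
    ∀ᵐ p : ℝ × (Fin n → ℝ) ∂(volume.restrict (E.Γ ×ˢ E.Θ)), ∀ j,
      E.virtualValue j p.1 (p.2 j) ≠ 0 → m.q p.1 p.2 j = E.pointwiseRule p.1 p.2 j := by
  rw [seqProfit_eq hind hm.1 hm.2.1, E.pointwiseMax_eq] at hopt
  have h2 : 0 ≤ E.truthPayoff m E.γlo := hm.2.2.2 _ E.γlo_mem
  have hms := E.measurableSet_Γ.prod E.measurableSet_Θ
  have h0 : 0 ≤ᵐ[volume.restrict (E.Γ ×ˢ E.Θ)] fun p => E.maxSurplus p - E.surplus m.q p := by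
    filter_upwards [ae_restrict_mem hms] with p hp
    exact sub_nonneg.2 (hm.1.surplus_le hp)
  -- The shortfall from the pointwise maximum is nonnegative and has integral zero, so it vanishes
  -- almost everywhere. It is a positive density times a sum of nonnegative terms, so each term
  -- vanishes.
  have h3 : ∫ p in E.Γ ×ˢ E.Θ, (E.maxSurplus p - E.surplus m.q p) = 0 := by
    refine le_antisymm ?_ (integral_nonneg_of_ae h0)
    rw [integral_sub E.integrableOn_maxSurplus hm.1.integrableOn_surplus]
    linarith
  rw [integral_eq_zero_iff_of_nonneg_ae h0
    (Integrable.sub E.integrableOn_maxSurplus hm.1.integrableOn_surplus)] at h3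
  filter_upwards [h3, ae_restrict_mem hms] with p hp hmem j hj
  have hq := hm.1.2.2 p.1 hmem.1 p.2 hmem.2
  have hg := E.g_pos p.1 hmem.1
  have hw := E.weightedValue_eq j hmem.1 (E.mem_Θ_iff.1 hmem.2 j)
  have hterm : ∀ i ∈ Finset.univ, 0 ≤ max (E.weightedValue i p.1 (p.2 i)) 0 -
      m.q p.1 p.2 i * E.weightedValue i p.1 (p.2 i) := fun i _ => by
    rw [sub_nonneg]
    rcases le_total 0 (E.weightedValue i p.1 (p.2 i)) with h | h
    · exact (mul_le_of_le_one_left h (hq i).2).trans (le_max_left _ _)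
    · exact (mul_nonpos_of_nonneg_of_nonpos (hq i).1 h).trans (le_max_right _ _)
  have hsum : ∑ i, (max (E.weightedValue i p.1 (p.2 i)) 0 -
      m.q p.1 p.2 i * E.weightedValue i p.1 (p.2 i)) = 0 := by
    simp only [maxSurplus, surplus, ← mul_sub, Pi.zero_apply, mul_eq_zero] at hp
    rw [Finset.sum_sub_distrib]
    exact hp.resolve_left (E.dens_pos _ _).ne'
  have hzero := (Finset.sum_eq_zero_iff_of_nonneg hterm).1 hsum j (Finset.mem_univ j)
  rw [hw] at hzero
  unfold pointwiseRule
  rcases lt_or_gt_of_ne hj with hneg | hpos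
  · rw [if_neg (not_le.2 hneg)]
    rw [max_eq_right (mul_nonpos_of_nonneg_of_nonpos hg.le hneg.le), zero_sub, neg_eq_zero] at hzero
    exact (mul_eq_zero.1 hzero).resolve_right (mul_neg_of_pos_of_neg hg hneg).ne
  · rw [if_pos hpos.le]
    rw [max_eq_left (mul_pos hg hpos).le] at hzero
    have h5 : (1 - m.q p.1 p.2 j) * (E.g p.1 * E.virtualValue j p.1 (p.2 j)) = 0 := by linarith
    linarith [(mul_eq_zero.1 h5).resolve_right (mul_pos hg hpos).ne']

end Environment

/-! ### From simultaneous to sequential implementability. -/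

namespace Environment

variable {n : ℕ} {E : Environment n} {M : SimMechanism n}

theorem net_payoff (γ' : ℝ) (θ' θ : Fin n → ℝ) : M.net.payoff γ' θ' θ = M.payoff γ' θ' θ := by
  simp only [SeqMechanism.payoff, SimMechanism.net, SimMechanism.payoff, sub_sub]

theorem lo_mem_Θ : E.lo ∈ E.Θ := E.mem_Θ_iff.2 fun j => E.lo_mem j

theorem SimFeasible.net (hM : E.SimFeasible M) : E.SeqFeasible M.net :=
  ⟨hM.1, (hM.2.1.comp measurable_fst).add hM.2.2.1, hM.2.2.2⟩

theorem SeqFeasible.measurable_payoff {m : SeqMechanism n} (hm : E.SeqFeasible m) (γ : ℝ) :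
    Measurable fun θ => m.payoff γ θ θ :=
  (Finset.measurable_sum _ fun j _ => (hm.measurable_q γ j).mul (measurable_pi_apply j)).sub
    (hm.2.1.comp measurable_prodMk_left)

theorem SimIC2.payoff_le (h : E.SimIC2 M) {γ : ℝ} (hγ : γ ∈ E.Γ) {θ θ' : Fin n → ℝ}
    (hθ : θ ∈ E.Θ) (hθ' : θ' ∈ E.Θ) : M.payoff γ θ' θ ≤ M.payoff γ θ θ := by
  have := h γ hγ θ hθ θ' hθ'
  unfold SimMechanism.payoff
  linarith

theorem SimIC2.iSup_payoff (h : E.SimIC2 M) {γ : ℝ} (hγ : γ ∈ E.Γ) {θ : Fin n → ℝ}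
    (hθ : θ ∈ E.Θ) : ⨆ θ' : E.Θ, M.payoff γ θ' θ = M.payoff γ θ θ := by
  have : Nonempty E.Θ := ⟨⟨θ, hθ⟩⟩
  refine le_antisymm (ciSup_le fun θ' => h.payoff_le hγ hθ θ'.2) ?_
  -- The truthful payoff bounds the set above; without a bound the real supremum would default to 0.
  refine le_ciSup (f := fun θ' : E.Θ => M.payoff γ θ' θ) ⟨M.payoff γ θ θ, ?_⟩ ⟨θ, hθ⟩
  rintro _ ⟨θ', rfl⟩
  exact h.payoff_le hγ hθ θ'.2

theorem SimIC2.integral_iSup_payoff (h : E.SimIC2 M) {γ γ' : ℝ} (hγ : γ ∈ E.Γ) (hγ' : γ' ∈ E.Γ) :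
    ∫ θ, (⨆ θ' : E.Θ, M.payoff γ' θ' θ) ∂(E.condLaw γ) =
      ∫ θ, M.payoff γ' θ θ ∂(E.condLaw γ) := by
  rw [E.integral_condLaw hγ, E.integral_condLaw hγ]
  exact setIntegral_congr_fun E.measurableSet_Θ fun θ hθ => by
    simp only [h.iSup_payoff hγ' hθ]

/-- The truthful payoff is bounded, as a maximum of functions with bounded slopes. -/
theorem SimIC2.exists_bound_payoff (hM : E.SimFeasible M) (h : E.SimIC2 M) {γ : ℝ}
    (hγ : γ ∈ E.Γ) : ∃ C, ∀ θ ∈ E.Θ, |M.payoff γ θ θ| ≤ C := by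
  obtain ⟨A, hA0, hA⟩ := E.exists_bound
  have hdiff : ∀ θ θ' : Fin n → ℝ, θ ∈ E.Θ → θ' ∈ E.Θ →
      M.payoff γ θ' θ' - M.payoff γ θ θ ≤ n * (2 * A) := by
    intro θ θ' hθ hθ'
    have h1 := h.payoff_le hγ hθ hθ'
    have h2 : M.payoff γ θ' θ' - M.payoff γ θ' θ =
        ∑ j, M.net.q γ θ' j * (θ' j - θ j) := by
      simp only [SimMechanism.payoff, SimMechanism.net, mul_sub, Finset.sum_sub_distrib]
      ring
    have h3 := hM.net.abs_sum_le hγ hθ' (v := fun j => θ' j - θ j) (C := 2 * A) fun j => by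
      have h4 := ((hA γ hγ θ hθ).2 j).1
      have h5 := ((hA γ hγ θ' hθ').2 j).1
      exact (abs_sub _ _).trans (by linarith)
    linarith [le_abs_self (∑ j, M.net.q γ θ' j * (θ' j - θ j))]
  refine ⟨|M.payoff γ E.lo E.lo| + n * (2 * A), fun θ hθ => abs_le.2 ⟨?_, ?_⟩⟩
  · linarith [hdiff θ E.lo hθ lo_mem_Θ, neg_abs_le (M.payoff γ E.lo E.lo)]
  · linarith [hdiff E.lo θ lo_mem_Θ hθ, le_abs_self (M.payoff γ E.lo E.lo)]

variable (E) in
theorem isProbabilityMeasure_contLaw {γ : ℝ} (hγ : γ ∈ E.Γ) (j : Fin n) (θ : Fin n → ℝ)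
    (i : Fin n) :
    IsProbabilityMeasure (if i ≤ j then Measure.dirac (θ i) else E.marginalLaw γ i) := by
  split_ifs
  · infer_instance
  · exact E.isProbabilityMeasure_marginalLaw i hγ

variable (E) in
theorem ae_contLaw_mem {γ : ℝ} (hγ : γ ∈ E.Γ) (j : Fin n) {θ : Fin n → ℝ} (hθ : θ ∈ E.Θ) :
    ∀ᵐ η ∂(E.contLaw γ j θ), η ∈ E.Θ := by
  have := E.isProbabilityMeasure_contLaw hγ j θ
  simp_rw [E.mem_Θ_iff, ae_all_iff]
  intro i
  refine (Measure.quasiMeasurePreserving_eval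
    (fun i => if i ≤ j then Measure.dirac (θ i) else E.marginalLaw γ i) i).ae
    (p := fun x => x ∈ Set.Icc (E.lo i) (E.hi i)) ?_
  split_ifs
  · exact (ae_dirac_iff measurableSet_Icc).2 (E.mem_Θ_iff.1 hθ i)
  · exact E.ae_marginalLaw_mem i hγ

/-- After any report γ', the second-period constraint makes truth about θ optimal at every
realization, whatever the true type. So each strategy is dominated pointwise by truth after γ', and
the remaining comparison of γ' with γ is the first-period constraint. In later periods pointwise
domination alone suffices. -/
theorem SimImplementable.net (hind : E.CondIndependent) (hM : E.SimImplementable M) :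
    E.SeqImplementable M.net := by
  obtain ⟨hf, h1, h2, hIR⟩ := hM
  have hmeas : ∀ γ, Measurable fun θ => M.payoff γ θ θ := fun γ => by
    simpa only [net_payoff] using hf.net.measurable_payoff γ
  have hint : ∀ γ ∈ E.Γ, ∀ γ' ∈ E.Γ,
      Integrable (fun θ => M.payoff γ' θ θ) (E.pathLaw γ) := fun γ hγ γ' hγ' => by
    obtain ⟨C, hC⟩ := h2.exists_bound_payoff hf hγ'
    exact E.integrable_pathLaw_of_bound hγ (hmeas γ') C hC
  refine ⟨hf.net, fun γ hγ => ⟨?_, fun γ' hγ' σ hσ hi => ?_⟩,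
    fun γ hγ θ hθ j => ⟨?_, fun σ hσ _ hi => ?_⟩, fun γ hγ => ?_⟩
  · simpa only [net_payoff] using hint γ hγ γ hγ
  · simp only [net_payoff] at hi ⊢
    refine (integral_mono_ae hi (hint γ hγ γ' hγ') ?_).trans ?_
    · filter_upwards [E.ae_pathLaw_mem hγ] with θ hθ
      exact h2.payoff_le hγ' hθ (hσ.2.1 θ hθ)
    · rw [E.pathLaw_eq hind hγ, ← h2.integral_iSup_payoff hγ hγ', ← h2.integral_iSup_payoff hγ hγ]
      exact h1 γ hγ γ' hγ'
  · have := E.isProbabilityMeasure_contLaw hγ j θ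
    obtain ⟨C, hC⟩ := h2.exists_bound_payoff hf hγ
    simp only [net_payoff]
    have : IsProbabilityMeasure (E.contLaw γ j θ) := by rw [contLaw]; infer_instance
    refine Integrable.of_bound (hmeas γ).aestronglyMeasurable C ?_
    filter_upwards [E.ae_contLaw_mem hγ j hθ] with η hη using hC η hη
  · have := E.isProbabilityMeasure_contLaw hγ j θ
    obtain ⟨C, hC⟩ := h2.exists_bound_payoff hf hγ
    simp only [net_payoff] at hi ⊢
    have : IsProbabilityMeasure (E.contLaw γ j θ) := by rw [contLaw]; infer_instance
    refine integral_mono_ae hi (Integrable.of_bound (hmeas γ).aestronglyMeasurable C ?_) ?_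
    · filter_upwards [E.ae_contLaw_mem hγ j hθ] with η hη using hC η hη
    · filter_upwards [E.ae_contLaw_mem hγ j hθ] with η hη
      exact h2.payoff_le hγ hη (hσ.2.1 η hη)
  · simp only [net_payoff]
    rw [E.pathLaw_eq hind hγ]
    exact hIR γ hγ

theorem seqProfit_net (hind : E.CondIndependent) (M : SimMechanism n) :
    E.seqProfit M.net = E.simProfit M := by
  rw [seqProfit, simProfit, E.integral_typeLaw, E.integral_typeLaw]
  refine setIntegral_congr_fun E.measurableSet_Γ fun γ hγ => ?_
  simp only [SimMechanism.net]
  rw [E.pathLaw_eq hind hγ]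

end Environment

/-! ### Posted prices that attain the upper bound. -/

namespace Environment

variable {n : ℕ} (E : Environment n)

/-- The types `x > lo j` that buy good `j` under the pointwise optimal allocation. -/
def buyers (j : Fin n) (γ : ℝ) : Set ℝ :=
  {x ∈ Set.Ioc (E.lo j) (E.hi j) | 0 ≤ E.virtualValue j γ x}

/-- The posted price of good `j` that implements the pointwise optimal allocation; a price above
`hi j` if good `j` is not sold. -/
def price (j : Fin n) (γ : ℝ) : ℝ :=
  sInf (E.buyers j (E.clampType γ) ∪ {E.hi j + 1})

theorem lo_mem_lowerBounds (j : Fin n) (γ : ℝ) :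
    E.lo j ∈ lowerBounds (E.buyers j γ ∪ {E.hi j + 1}) := by
  rintro x (hx | rfl)
  · exact hx.1.1.le
  · linarith [E.lo_lt_hi j]

theorem virtualValue_eq (j : Fin n) {γ x : ℝ} (hγ : γ ∈ E.Γ)
    (hx : x ∈ Set.Icc (E.lo j) (E.hi j)) : E.virtualValue j γ x =
      x + E.cdfDeriv j γ x / E.mdens j γ x * ((1 - E.G γ) / E.g γ) := by
  rw [virtualValue, E.marginalCDFDeriv_eq j hγ hx, E.mdens_eq_marginalDensity j hγ hx]

theorem continuousOn_virtualValue (j : Fin n) {γ : ℝ} (hγ : γ ∈ E.Γ) :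
    ContinuousOn (E.virtualValue j γ) (Set.Icc (E.lo j) (E.hi j)) := by
  have h : Continuous fun x => x + E.cdfDeriv j γ x / E.mdens j γ x * ((1 - E.G γ) / E.g γ) :=
    continuous_id.add (((E.continuous_cdfDeriv_right j γ).div (E.continuous_mdens_right j γ)
      fun x => (E.mdens_pos j γ x).ne').mul continuous_const)
  exact h.continuousOn.congr fun x hx => E.virtualValue_eq j hγ hx

variable {E}

theorem Regular.antitone_price (hreg : E.Regular) (j : Fin n) : Antitone (E.price j) := by
  intro γ γ' h
  refine csInf_le_csInf ⟨_, E.lo_mem_lowerBounds j _⟩ ⟨_, Or.inr rfl⟩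
    (Set.union_subset_union_left _ fun x hx => ⟨hx.1, hx.2.trans ?_⟩)
  exact hreg.mono j x (Set.Ioc_subset_Icc_self hx.1) (E.clampType_mem _) (E.clampType_mem _)
    (E.monotone_clampType h)

theorem Regular.virtualValue_le (hreg : E.Regular) (j : Fin n) {γ x : ℝ} (hγ : γ ∈ E.Γ)
    (hx : x ∈ Set.Icc (E.lo j) (E.hi j)) : E.virtualValue j γ x ≤ x := by
  rw [E.virtualValue_eq j hγ hx]
  have h1 : E.cdfDeriv j γ x ≤ 0 := E.marginalCDFDeriv_eq j hγ hx ▸ hreg.deriv_nonpos j γ hγ x hx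
  have h2 := div_nonpos_of_nonpos_of_nonneg h1 (E.mdens_pos j γ x).le
  have h3 : 0 ≤ (1 - E.G γ) / E.g γ :=
    div_nonneg (sub_nonneg.2 (E.G_le_one γ)) (E.g_pos γ hγ).le
  linarith [mul_nonpos_of_nonpos_of_nonneg h2 h3]

/-- Inside the interval this is single crossing. At `hi j` the distortion vanishes, so the virtual
value is `hi j` itself, which is at least y and thus at least φ(y) ≥ 0. -/
theorem Regular.buyers_upward (hreg : E.Regular) (j : Fin n) {γ x y : ℝ} (hγ : γ ∈ E.Γ)
    (hx : x ∈ Set.Ioc (E.lo j) (E.hi j)) (hy : y ∈ E.buyers j γ) (hyx : y ≤ x) :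
    0 ≤ E.virtualValue j γ x := by
  rcases hx.2.eq_or_lt with rfl | hlt
  · rw [E.virtualValue_eq j hγ (E.hi_mem j), E.cdfDeriv_hi j hγ]
    have := hreg.virtualValue_le j hγ (Set.Ioc_subset_Icc_self hy.1)
    simp only [zero_div, zero_mul, add_zero]
    linarith [hy.2]
  · exact hreg.single_crossing j γ hγ y ⟨hy.1.1, hyx.trans_lt hlt⟩ x ⟨hx.1, hlt⟩ hyx hy.2

/-- If x has a negative virtual value, no buyer lies below x because buyers form an upper set, and
none lies just above x by continuity. So the infimum exceeds x strictly. -/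
theorem Regular.price_le_iff (hreg : E.Regular) (j : Fin n) {γ x : ℝ} (hγ : γ ∈ E.Γ)
    (hx : x ∈ Set.Ioc (E.lo j) (E.hi j)) : E.price j γ ≤ x ↔ 0 ≤ E.virtualValue j γ x := by
  rw [price, E.clampType_of_mem hγ]
  refine ⟨fun h => ?_, fun h => csInf_le ⟨_, E.lo_mem_lowerBounds j _⟩ (Or.inl ⟨hx, h⟩)⟩
  by_contra hneg
  rw [not_le] at hneg
  have hev := (E.continuousOn_virtualValue j hγ x (Set.Ioc_subset_Icc_self hx)).eventually
    (Iio_mem_nhds hneg)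
  obtain ⟨ε, hε, hball⟩ := Metric.mem_nhdsWithin_iff.1 hev
  -- The 1 accounts for the extra point `hi j + 1` in the definition of the price.
  have hlow : x + min ε 1 ≤ sInf (E.buyers j γ ∪ {E.hi j + 1}) := by
    refine le_csInf ⟨_, Or.inr rfl⟩ ?_
    rintro y (hy | rfl)
    · by_contra hlt
      rw [not_le] at hlt
      rcases le_total y x with hyx | hyx
      · exact absurd (hreg.buyers_upward j hγ hx hy hyx) (not_le.2 hneg)
      · have : y ∈ Metric.ball x ε := by
          rw [Metric.mem_ball, Real.dist_eq, abs_of_nonneg (sub_nonneg.2 hyx)]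
          linarith [min_le_left ε 1]
        exact absurd hy.2 (not_le.2 (hball ⟨this, Set.Ioc_subset_Icc_self hy.1⟩))
    · linarith [min_le_right ε 1, hx.2]
  have : 0 < min ε 1 := lt_min hε one_pos
  linarith

variable (E)

/-- The expected consumer surplus from good `j` at price `c`, given `γ`. -/
def optionValue (j : Fin n) (c γ : ℝ) : ℝ :=
  ∫ x in (E.lo j)..(E.hi j), max (x - c) 0 * E.mdens j γ x

/-- The derivative of `optionValue` in the type. -/
def optionRate (j : Fin n) (c γ : ℝ) : ℝ :=
  ∫ x in (E.lo j)..(E.hi j), if c ≤ x then -E.cdfDeriv j γ x else 0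

/-- Integration by parts in the valuation: F_γ vanishes at both ends, and the option payoff has
slope 1 above the strike and 0 below. The kink at c is a null set. -/
theorem integral_mul_mdensDeriv (j : Fin n) (c : ℝ) {s : ℝ} (hs : s ∈ E.Γ) :
    ∫ x in (E.lo j)..(E.hi j), max (x - c) 0 * E.mdensDeriv j s x = E.optionRate j c s := by
  have hu : LipschitzWith 1 fun x : ℝ => max (x - c) 0 := by
    refine LipschitzWith.max_const (LipschitzWith.of_dist_le_mul fun x y => ?_) 0
    simp
  have hu' : AbsolutelyContinuousOnInterval (fun x : ℝ => max (x - c) 0) (E.lo j) (E.hi j) :=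
    (hu.lipschitzOnWith (s := _)).absolutelyContinuousOnInterval
  have hD : AbsolutelyContinuousOnInterval (E.cdfDeriv j s) (E.lo j) (E.hi j) :=
    ((E.continuous_mdensDeriv_right j s).intervalIntegrable _ _
      ).absolutelyContinuousOnInterval_intervalIntegral Set.left_mem_uIcc
  have h := hu'.integral_mul_deriv_eq_deriv_mul hD
  simp_rw [fun x => (E.hasDerivAt_cdfDeriv j s x).deriv] at h
  rw [h, E.cdfDeriv_lo, E.cdfDeriv_hi j hs, mul_zero, mul_zero, sub_zero, zero_sub, optionRate,
    ← intervalIntegral.integral_neg]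
  refine intervalIntegral.integral_congr_ae ?_
  filter_upwards [Measure.ae_ne (volume : Measure ℝ) c] with x hx _
  rcases lt_or_gt_of_ne hx with hlt | hgt
  · have : (fun y : ℝ => max (y - c) 0) =ᶠ[nhds x] fun _ => 0 := by
      filter_upwards [Iio_mem_nhds hlt] with y hy
      exact max_eq_right (sub_nonpos.2 (le_of_lt hy))
    rw [this.deriv_eq, deriv_const, if_neg (not_le.2 hlt)]
    simp
  · have : (fun y : ℝ => max (y - c) 0) =ᶠ[nhds x] fun y => y - c := by
      filter_upwards [Ioi_mem_nhds hgt] with y hy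
      exact max_eq_left (sub_nonneg.2 (le_of_lt hy))
    rw [this.deriv_eq, ((hasDerivAt_id' x).sub_const c).deriv, if_pos hgt.le, one_mul]

theorem optionValue_sub (j : Fin n) (c : ℝ) {γ γ' : ℝ} (hγ : γ ∈ E.Γ) (hγ' : γ' ∈ E.Γ) :
    E.optionValue j c γ' - E.optionValue j c γ = ∫ s in γ..γ', E.optionRate j c s := by
  have hc : Continuous fun x : ℝ => max (x - c) 0 := by fun_prop
  have hi : ∀ γ, IntervalIntegrable (fun x => max (x - c) 0 * E.mdens j γ x) volume
      (E.lo j) (E.hi j) := fun γ =>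
    (hc.mul (E.continuous_mdens_right j γ)).intervalIntegrable _ _
  have hle := (E.lo_lt_hi j).le
  have hswap := intervalIntegral_setIntegral_swap (μ := (volume : Measure ℝ))
    (h := fun s x => max (x - c) 0 * E.mdensDeriv j s x)
    ((hc.comp continuous_snd).mul (E.continuous_mdensDeriv j))
    (isCompact_Icc (a := E.lo j) (b := E.hi j)) γ γ'
  simp_rw [integral_Icc_eq_integral_Ioc, ← intervalIntegral.integral_of_le hle] at hswap
  unfold optionValue
  rw [← intervalIntegral.integral_sub (hi _) (hi _)]
  simp_rw [← mul_sub, ← E.mdens_sub j hγ hγ', ← intervalIntegral.integral_const_mul]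
  rw [← hswap]
  refine intervalIntegral.integral_congr fun s hs => ?_
  exact E.integral_mul_mdensDeriv j c (Set.uIcc_subset_Icc hγ hγ' hs)

theorem integrableOn_optionIntegrand (j : Fin n) (c γ : ℝ) :
    IntervalIntegrable (fun x => if c ≤ x then -E.cdfDeriv j γ x else 0) volume
      (E.lo j) (E.hi j) := by
  have h : IntervalIntegrable (fun x => -E.cdfDeriv j γ x) volume (E.lo j) (E.hi j) :=
    (E.continuous_cdfDeriv_right j γ).neg.intervalIntegrable _ _
  rw [intervalIntegrable_iff] at h ⊢
  exact h.indicator measurableSet_Ici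

theorem integrableOn_optionRate (j : Fin n) {c : ℝ → ℝ} (hc : Measurable c) :
    IntegrableOn (fun s => E.optionRate j (c s) s) E.Γ := by
  have hle := (E.lo_lt_hi j).le
  have hH : Measurable fun p : ℝ × ℝ => if c p.1 ≤ p.2 then -E.cdfDeriv j p.1 p.2 else 0 :=
    Measurable.ite (measurableSet_le (hc.comp measurable_fst) measurable_snd)
      (E.continuous_cdfDeriv j).measurable.neg measurable_const
  have hcpt : IsCompact (E.Γ ×ˢ Set.Icc (E.lo j) (E.hi j)) := isCompact_Icc.prod isCompact_Icc
  obtain ⟨C, hC⟩ := hcpt.exists_bound_of_continuousOn (E.continuous_cdfDeriv j).continuousOn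
  have hi : IntegrableOn (fun p : ℝ × ℝ => if c p.1 ≤ p.2 then -E.cdfDeriv j p.1 p.2 else 0)
      (E.Γ ×ˢ Set.Icc (E.lo j) (E.hi j)) := by
    refine Measure.integrableOn_of_bounded (M := C) hcpt.measure_lt_top.ne
      hH.aestronglyMeasurable ?_
    filter_upwards [ae_restrict_mem (E.measurableSet_Γ.prod measurableSet_Icc)] with p hp
    split_ifs
    · rw [norm_neg]; exact hC p hp
    · rw [norm_zero]; exact (norm_nonneg _).trans (hC p hp)
  rw [IntegrableOn, Measure.volume_eq_prod, ← Measure.prod_restrict] at hi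
  have h := hi.integral_prod_left
  simp_rw [integral_Icc_eq_integral_Ioc, ← intervalIntegral.integral_of_le hle] at h
  exact h

/-- The payoff of type `γ` under the optimal mechanism. -/
def rent (γ : ℝ) : ℝ := ∫ s in E.γlo..γ, ∑ j, E.optionRate j (E.price j s) s

/-- The payment for the menu of posted prices, for `γ ∈ Γ`. -/
def entryFee (γ : ℝ) : ℝ := ∑ j, E.optionValue j (E.price j γ) γ - E.rent γ

/-- Posted prices that depend on the report of `γ`. -/
def postedPrices : SimMechanism n where
  q := fun γ θ j => if E.price j γ ≤ θ j then 1 else 0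
  t₁ := fun γ => E.entryFee (E.clampType γ)
  t₂ := fun γ θ => ∑ j, if E.price j γ ≤ θ j then E.price j γ else 0

variable {E}

theorem Regular.cdfDeriv_nonpos (hreg : E.Regular) (j : Fin n) {γ x : ℝ} (hγ : γ ∈ E.Γ)
    (hx : x ∈ Set.Icc (E.lo j) (E.hi j)) : E.cdfDeriv j γ x ≤ 0 :=
  E.marginalCDFDeriv_eq j hγ hx ▸ hreg.deriv_nonpos j γ hγ x hx

/-- A lower price enlarges the range over which the nonnegative function -F_γ is integrated. -/
theorem Regular.optionRate_anti (hreg : E.Regular) (j : Fin n) {γ : ℝ} (hγ : γ ∈ E.Γ) {c c' : ℝ}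
    (h : c ≤ c') : E.optionRate j c' γ ≤ E.optionRate j c γ := by
  refine intervalIntegral.integral_mono_on (E.lo_lt_hi j).le
    (E.integrableOn_optionIntegrand j c' γ) (E.integrableOn_optionIntegrand j c γ) fun x hx => ?_
  have := hreg.cdfDeriv_nonpos j hγ hx
  split_ifs with h1 h2
  · exact le_rfl
  · exact absurd (h.trans h1) h2
  · linarith
  · exact le_rfl

theorem Regular.optionRate_nonneg (hreg : E.Regular) (j : Fin n) {γ : ℝ} (hγ : γ ∈ E.Γ) (c : ℝ) :
    0 ≤ E.optionRate j c γ := by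
  refine intervalIntegral.integral_nonneg (E.lo_lt_hi j).le fun x hx => ?_
  have := hreg.cdfDeriv_nonpos j hγ hx
  split_ifs
  · linarith
  · exact le_rfl

theorem optionValue_anti (j : Fin n) (γ : ℝ) {c c' : ℝ} (h : c ≤ c') :
    E.optionValue j c' γ ≤ E.optionValue j c γ := by
  have hi := fun c : ℝ => ((by fun_prop : Continuous fun x : ℝ => max (x - c) 0).mul
    (E.continuous_mdens_right j γ)).intervalIntegrable (μ := volume) (E.lo j) (E.hi j)
  refine intervalIntegral.integral_mono_on (E.lo_lt_hi j).le (hi c') (hi c) fun x _ => ?_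
  exact mul_le_mul_of_nonneg_right (max_le_max (by linarith) le_rfl) (E.mdens_pos j γ x).le

theorem Regular.integrableOn_rentRate (hreg : E.Regular) :
    IntegrableOn (fun s => ∑ j, E.optionRate j (E.price j s) s) E.Γ :=
  integrable_finsetSum _ fun j _ => E.integrableOn_optionRate j (hreg.antitone_price j).measurable

theorem intervalIntegrable_of_integrableOn_Γ {h : ℝ → ℝ} (hh : IntegrableOn h E.Γ) {γ γ' : ℝ}
    (hγ : γ ∈ E.Γ) (hγ' : γ' ∈ E.Γ) : IntervalIntegrable h volume γ γ' :=
  intervalIntegrable_iff.2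
    (hh.mono_set (Set.uIoc_subset_uIcc.trans (Set.uIcc_subset_Icc hγ hγ')))

theorem Regular.rent_sub (hreg : E.Regular) {γ γ' : ℝ} (hγ : γ ∈ E.Γ) (hγ' : γ' ∈ E.Γ) :
    E.rent γ' - E.rent γ = ∫ s in γ..γ', ∑ j, E.optionRate j (E.price j s) s :=
  intervalIntegral.integral_interval_sub_left
    (intervalIntegrable_of_integrableOn_Γ hreg.integrableOn_rentRate E.γlo_mem hγ')
    (intervalIntegrable_of_integrableOn_Γ hreg.integrableOn_rentRate E.γlo_mem hγ)

theorem Regular.rent_nonneg (hreg : E.Regular) {γ : ℝ} (hγ : γ ∈ E.Γ) : 0 ≤ E.rent γ :=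
  intervalIntegral.integral_nonneg hγ.1 fun _ hs => Finset.sum_nonneg fun j _ =>
    hreg.optionRate_nonneg j ⟨hs.1, hs.2.trans hγ.2⟩ _

/-- Type `γ` does not gain from reporting `γ'`. -/
theorem Regular.sum_optionValue_sub_le (hreg : E.Regular) {γ γ' : ℝ} (hγ : γ ∈ E.Γ)
    (hγ' : γ' ∈ E.Γ) :
    ∑ j, E.optionValue j (E.price j γ') γ - ∑ j, E.optionValue j (E.price j γ') γ' ≤
      E.rent γ - E.rent γ' := by
  rw [← Finset.sum_sub_distrib, hreg.rent_sub hγ' hγ]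
  simp_rw [fun j => E.optionValue_sub j (E.price j γ') hγ' hγ]
  have hi : ∀ j, IntegrableOn (fun s => E.optionRate j (E.price j γ') s) E.Γ := fun j =>
    E.integrableOn_optionRate j measurable_const
  have hsum : IntegrableOn (fun s => ∑ j, E.optionRate j (E.price j γ') s) E.Γ :=
    integrable_finsetSum _ fun j _ => hi j
  rw [← intervalIntegral.integral_finsetSum fun j _ =>
    intervalIntegrable_of_integrableOn_Γ (hi j) hγ' hγ]
  -- Between the two types, the deviator's payoff grows at the rate for the fixed price of γ', the
  -- rent at the rate for the running price. Above γ' running prices are lower and rates higher;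
  -- below γ' the reverse, and there the integrals change sign.
  rcases le_total γ' γ with h | h
  · refine intervalIntegral.integral_mono_on h
      (intervalIntegrable_of_integrableOn_Γ hsum hγ' hγ)
      (intervalIntegrable_of_integrableOn_Γ hreg.integrableOn_rentRate hγ' hγ) fun s hs => ?_
    exact Finset.sum_le_sum fun j _ => hreg.optionRate_anti j
      ⟨hγ'.1.trans hs.1, hs.2.trans hγ.2⟩ (hreg.antitone_price j hs.1)
  · rw [intervalIntegral.integral_symm, intervalIntegral.integral_symm γ γ', neg_le_neg_iff]
    refine intervalIntegral.integral_mono_on h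
      (intervalIntegrable_of_integrableOn_Γ hreg.integrableOn_rentRate hγ hγ')
      (intervalIntegrable_of_integrableOn_Γ hsum hγ hγ') fun s hs => ?_
    exact Finset.sum_le_sum fun j _ => hreg.optionRate_anti j
      ⟨hγ.1.trans hs.1, hs.2.trans hγ'.2⟩ (hreg.antitone_price j hs.2)

/-- If a higher report lowered the fee as well as the prices, the lower type would gain from it.
Monotonicity is what makes the fee measurable. -/
theorem Regular.monotoneOn_entryFee (hreg : E.Regular) : MonotoneOn E.entryFee E.Γ := by
  intro γ hγ γ' hγ' h
  have h1 := hreg.sum_optionValue_sub_le hγ hγ'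
  have h2 : ∑ j, E.optionValue j (E.price j γ) γ ≤ ∑ j, E.optionValue j (E.price j γ') γ :=
    Finset.sum_le_sum fun j _ => optionValue_anti j γ (hreg.antitone_price j h)
  unfold entryFee
  linarith

theorem Regular.simFeasible_postedPrices (hreg : E.Regular) : E.SimFeasible E.postedPrices := by
  have hp : ∀ j, Measurable fun p : ℝ × (Fin n → ℝ) => E.price j p.1 := fun j =>
    (hreg.antitone_price j).measurable.comp measurable_fst
  have hs : ∀ j, MeasurableSet {p : ℝ × (Fin n → ℝ) | E.price j p.1 ≤ p.2 j} := fun j =>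
    measurableSet_le (hp j) (by fun_prop)
  refine ⟨measurable_pi_lambda _ fun j => Measurable.ite (hs j) measurable_const measurable_const,
    Monotone.measurable fun x y hxy => hreg.monotoneOn_entryFee (E.clampType_mem _)
      (E.clampType_mem _) (E.monotone_clampType hxy),
    Finset.measurable_sum Finset.univ fun j _ => Measurable.ite (hs j) (hp j) measurable_zero,
    fun γ _ θ _ j => ?_⟩
  simp only [postedPrices]
  split_ifs <;> simp

theorem simIC2_postedPrices : E.SimIC2 E.postedPrices := by
  intro γ _ θ _ θ' _
  simp only [postedPrices, ← Finset.sum_sub_distrib]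
  refine Finset.sum_le_sum fun j _ => ?_
  split_ifs <;> linarith

theorem payoff_postedPrices {γ : ℝ} (hγ : γ ∈ E.Γ) (θ : Fin n → ℝ) :
    E.postedPrices.payoff γ θ θ = ∑ j, max (θ j - E.price j γ) 0 - E.entryFee γ := by
  simp only [SimMechanism.payoff, postedPrices, E.clampType_of_mem hγ]
  rw [sub_right_comm, ← Finset.sum_sub_distrib]
  congr 2
  ext j
  split_ifs with h
  · rw [max_eq_left (sub_nonneg.2 h), one_mul]
  · rw [max_eq_right (by linarith)]; ring

theorem integral_condLaw_max (j : Fin n) (c : ℝ) {γ : ℝ} (hγ : γ ∈ E.Γ) :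
    ∫ θ, max (θ j - c) 0 ∂(E.condLaw γ) = E.optionValue j c γ := by
  have hm : Measurable fun x : ℝ => max (x - c) 0 := by fun_prop
  have h := integral_map (μ := E.condLaw γ) (measurable_pi_apply j).aemeasurable
    hm.aestronglyMeasurable
  rw [← h]
  change ∫ x, max (x - c) 0 ∂(E.marginalLaw γ j) = _
  rw [E.marginalLaw_eq j hγ, integral_withDensity_eq_integral_toReal_smul
    (E.continuous_mdens_right j γ).measurable.ennreal_ofReal
    (Filter.Eventually.of_forall fun _ => ENNReal.ofReal_lt_top), optionValue,
    intervalIntegral.integral_of_le (E.lo_lt_hi j).le, ← integral_Icc_eq_integral_Ioc]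
  congr 1
  ext x
  rw [ENNReal.toReal_ofReal (E.mdens_pos j γ x).le, smul_eq_mul, mul_comm]

/-- The payoff separates across goods, so only the marginals of the joint law matter. -/
theorem integral_payoff_postedPrices {γ γ' : ℝ} (hγ : γ ∈ E.Γ) (hγ' : γ' ∈ E.Γ) :
    ∫ θ, E.postedPrices.payoff γ' θ θ ∂(E.condLaw γ) =
      ∑ j, E.optionValue j (E.price j γ') γ - E.entryFee γ' := by
  have := E.isProbabilityMeasure_condLaw hγ
  obtain ⟨A, hA0, hA⟩ := E.exists_bound
  have hi : ∀ j : Fin n, Integrable (fun θ : Fin n → ℝ => max (θ j - E.price j γ') 0)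
      (E.condLaw γ) := fun j => by
    refine Integrable.of_bound (Measurable.aestronglyMeasurable (by fun_prop))
      (A + |E.price j γ'|) ?_
    have hae : ∀ᵐ θ ∂(E.condLaw γ), θ ∈ E.Θ :=
      (withDensity_absolutelyContinuous _ _).ae_le (ae_restrict_mem E.measurableSet_Θ)
    filter_upwards [hae] with θ hθ
    rw [Real.norm_eq_abs, abs_of_nonneg (le_max_right _ _)]
    have h1 := ((hA γ hγ θ hθ).2 j).1
    refine max_le ?_ (by positivity)
    linarith [le_abs_self (θ j), neg_abs_le (E.price j γ')]
  simp_rw [payoff_postedPrices hγ']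
  rw [integral_sub (integrable_finsetSum _ fun j _ => hi j) (integrable_const _),
    integral_finsetSum _ fun j _ => hi j]
  simp_rw [fun j => integral_condLaw_max j (E.price j γ') hγ]
  simp

theorem integral_truth_postedPrices {γ : ℝ} (hγ : γ ∈ E.Γ) :
    ∫ θ, E.postedPrices.payoff γ θ θ ∂(E.condLaw γ) = E.rent γ := by
  rw [integral_payoff_postedPrices hγ hγ, entryFee]
  ring

theorem Regular.simImplementable_postedPrices (hreg : E.Regular) :
    E.SimImplementable E.postedPrices := by
  refine ⟨hreg.simFeasible_postedPrices, fun γ hγ γ' hγ' => ?_, simIC2_postedPrices,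
    fun γ hγ => ?_⟩
  · rw [simIC2_postedPrices.integral_iSup_payoff hγ hγ',
      simIC2_postedPrices.integral_iSup_payoff hγ hγ, integral_truth_postedPrices hγ,
      integral_payoff_postedPrices hγ hγ', entryFee]
    linarith [hreg.sum_optionValue_sub_le hγ hγ']
  · rw [integral_truth_postedPrices hγ]
    exact hreg.rent_nonneg hγ

theorem Regular.q_postedPrices (hreg : E.Regular) {γ : ℝ} (hγ : γ ∈ E.Γ) {θ : Fin n → ℝ}
    (hθ : θ ∈ E.Θ) (j : Fin n) (hj : E.lo j < θ j) :
    E.postedPrices.q γ θ j = E.pointwiseRule γ θ j := by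
  simp only [postedPrices, pointwiseRule,
    hreg.price_le_iff j hγ ⟨hj, (E.mem_Θ_iff.1 hθ j).2⟩]

/-- In the revenue formula the lowest type's rent is zero and the allocation maximizes the virtual
surplus pointwise. -/
theorem Regular.seqProfit_postedPrices (hreg : E.Regular) (hind : E.CondIndependent) :
    E.seqProfit E.postedPrices.net = E.pointwiseMax := by
  have himp := hreg.simImplementable_postedPrices.net hind
  have h0 : E.truthPayoff E.postedPrices.net E.γlo = 0 := by
    unfold truthPayoff
    simp only [net_payoff]
    rw [E.pathLaw_eq hind E.γlo_mem, integral_truth_postedPrices E.γlo_mem, rent,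
      intervalIntegral.integral_same]
  rw [seqProfit_eq hind himp.1 himp.2.1, h0, sub_zero, E.pointwiseMax_eq]
  refine setIntegral_congr_ae (E.measurableSet_Γ.prod E.measurableSet_Θ) ?_
  -- At `θ j = lo j` the posted price may disagree with the pointwise rule, but these points are
  -- negligible.
  have hne : ∀ᵐ p : ℝ × (Fin n → ℝ), ∀ j, p.2 j ≠ E.lo j := by
    rw [ae_all_iff]
    intro j
    have h1 : ∀ᵐ θ : Fin n → ℝ, θ j ≠ E.lo j :=
      (Measure.quasiMeasurePreserving_eval (fun _ : Fin n => (volume : Measure ℝ)) j).ae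
        (Measure.ae_ne volume (E.lo j))
    exact Measure.quasiMeasurePreserving_snd.ae h1
  filter_upwards [hne] with p hp hmem
  simp only [surplus, maxSurplus]
  congr 2
  ext j
  have hθ := E.mem_Θ_iff.1 hmem.2 j
  have hg := E.g_pos p.1 hmem.1
  have hq : E.postedPrices.net.q p.1 p.2 j = E.pointwiseRule p.1 p.2 j :=
    hreg.q_postedPrices hmem.1 hmem.2 j (lt_of_le_of_ne hθ.1 (hp j).symm)
  rw [hq, E.weightedValue_eq j hmem.1 hθ, pointwiseRule]
  split_ifs with h
  · rw [one_mul, max_eq_left (mul_nonneg hg.le h)]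
  · rw [zero_mul, max_eq_right (mul_nonpos_of_nonneg_of_nonpos hg.le (not_le.1 h).le)]

theorem nonanticipating_postedPrices : E.postedPrices.net.Nonanticipating := by
  intro γ j θ θ' h
  simp only [SimMechanism.net, postedPrices, h j le_rfl]

end Environment

end

theorem proposition1 (n : ℕ) (E : Environment n) (hreg : E.Regular) (hind : E.CondIndependent) :
    -- what can be implemented simultaneously can be implemented sequentially, at the same profit
    (∀ M : SimMechanism n, E.SimImplementable M →
      E.SeqImplementable M.net ∧ E.seqProfit M.net = E.simProfit M) ∧
    -- one mechanism, with the pointwise optimal allocation, solves both problems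
    (∃ M : SimMechanism n, E.SimOptimal M ∧ E.SeqOptimal M.net ∧ M.net.Nonanticipating ∧
      (∀ γ ∈ E.Γ, ∀ θ ∈ E.Θ, ∀ j, E.lo j < θ j → M.q γ θ j = E.pointwiseRule γ θ j) ∧
      E.simProfit M = E.pointwiseMax ∧ E.seqProfit M.net = E.pointwiseMax) ∧
    -- every solution of either problem has the pointwise optimal allocation, up to null sets and
    -- ties of the pointwise maximization
    (∀ M : SimMechanism n, E.SimOptimal M →
      ∀ᵐ p : ℝ × (Fin n → ℝ) ∂(volume.restrict (E.Γ ×ˢ E.Θ)), ∀ j,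
        E.virtualValue j p.1 (p.2 j) ≠ 0 → M.q p.1 p.2 j = E.pointwiseRule p.1 p.2 j) ∧
    (∀ m : SeqMechanism n, E.SeqOptimal m →
      ∀ᵐ p : ℝ × (Fin n → ℝ) ∂(volume.restrict (E.Γ ×ˢ E.Θ)), ∀ j,
        E.virtualValue j p.1 (p.2 j) ≠ 0 → m.q p.1 p.2 j = E.pointwiseRule p.1 p.2 j) := by
  have himp := hreg.simImplementable_postedPrices
  have hseq := hreg.seqProfit_postedPrices hind
  have hsim : E.simProfit E.postedPrices = E.pointwiseMax :=
    (Environment.seqProfit_net hind _).symm.trans hseq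
  refine ⟨fun M hM => ⟨hM.net hind, Environment.seqProfit_net hind M⟩,
    ⟨E.postedPrices, ⟨himp, fun M hM => ?_⟩, ⟨himp.net hind, fun m hm => ?_⟩,
      Environment.nonanticipating_postedPrices,
      fun γ hγ θ hθ j hj => hreg.q_postedPrices hγ hθ j hj, hsim, hseq⟩,
    fun M hM => ?_, fun m hm => ?_⟩
  · rw [hsim, ← Environment.seqProfit_net hind M]
    exact Environment.seqProfit_le_pointwiseMax hind (hM.net hind)
  · rw [hseq]
    exact Environment.seqProfit_le_pointwiseMax hind hm
  -- Posted prices attain the upper bound, so every optimum attains it too.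
  · refine Environment.ae_eq_pointwiseRule hind (hM.1.net hind) ?_
    rw [Environment.seqProfit_net hind M, ← hsim]
    exact hM.2 _ himp
  · refine Environment.ae_eq_pointwiseRule hind hm.1 ?_
    rw [← hseq]
    exact hm.2 _ (himp.net hind)
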